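/- Definitions. A meet-semilattice (a poset with all finite meets, hence with a top $1$) is distributive if $a\wedge b\le c$ implies $c=a'\wedge b'$ for some $a'\ge a$, $b'\ge b$. $\mathsf{BDMS}$ is the category of distributive meet-semilattices with a bottom element and maps preserving finite meets (including $1$). $\mathsf{KAlgFrm_J}$ is the category of compact algebraic frames (algebraic lattices that are frames and whose top is compact) and maps preserving arbitrary joins and compact elements. Let $X$ be a Priestley space (a compact partially ordered space in which $x\not\le y$ implies that some clopen upset contains $x$ and misses $y$) and $X_0\subseteq X$. A clopen upset $U$ is admissible if every maximal element of $X\setminus U$ is in $X_0$; $\mathcal A(X)$ is the set of these. A closed upset $C$ is admissible if $X\setminus C={\downarrow}(X_0\setminus C)$; $\mathcal V^a(X)$ is the set of these. $(X,X_0)$ is a generalized Priestley space if $X_0$ is topologically dense, every $x\in X$ is below some $y\in X_0$, $x\in X_0$ iff $\{U\in\mathcal A(X): x\notin U\}$ is directed under $\subseteq$, and $x\le y$ iff every $U\in\mathcal A(X)$ containing $x$ contains $y$. For $R\subseteq X\times Y$ and $U\subseteq Y$ put $\Box_RU=\{x: R[x]\subseteq U\}$. $R$ is a generalized Priestley morphism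 if (1) $\neg\, xRy$ implies that there is $U\in\mathcal A(Y)$ with $R[x]\subseteq U$, $y\notin U$; (2) $U\in\mathcal A(Y)$ implies $\Box_RU\in\mathcal A(X)$. $\mathsf{GPS}$ is the category of generalized Priestley spaces and these morphisms; the identity of $X$ is $\le$, and $x(S*R)z$ iff every $U\in\mathcal A(Z)$ with $x\in\Box_R\Box_SU$ contains $z$. Statement. The following are well-defined functors. - $\mathcal F:\mathsf{BDMS}\to\mathsf{KAlgFrm_J}$ sends $M$ to its lattice $\mathrm{Filt}(M)$ of filters under inclusion, and $\alpha$ to $F\mapsto{\uparrow}\alpha[F]$. - $\mathcal K:\mathsf{KAlgFrm_J}\to\mathsf{BDMS}$ sends $L$ to its set $K(L)$ of compact elements with the order $\ge$, and $\alpha$ to its restriction. - $\mathcal A:\mathsf{GPS}^{op}\to\mathsf{BDMS}$ sends $X$ to $(\mathcal A(X),\subseteq)$, and $R$ to $\Box_R$. - $\mathcal V^a:\mathsf{GPS}^{op}\to\mathsf{KAlgFrm_J}$ sends $X$ to $(\mathcal V^a(X),\supseteq)$, and $R$ to $\Box_R$. - $\mathcal X:\mathsf{BDMS}\to\mathsf{GPS}^{op}$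 sends $M$ to the set $\mathrm{Opt}(M)$ of optimal filters ordered by inclusion, with the topology generated by the sets $\{x: a\in x\}$ ($a\in M$) and their complements and with distinguished subset the set of prime filters, and sends $\alpha$ to $R_\alpha$, where $xR_\alpha y$ iff $\alpha^{-1}(x)\subseteq y$. Here a filter $P$ is prime if it is proper and $F_1\cap F_2\subseteq P$ implies $F_1\subseteq P$ or $F_2\subseteq P$ for all filters $F_1,F_2$; a filter is optimal if it is the preimage of a prime filter of the distributive envelope $D(M)$ under $M\to D(M)$, $D$ being left adjoint to the forgetful functor from bounded distributive lattices to $\mathsf{BDMS}$-objects with maps preserving finite meets and existing finite joins. - $\mathcal Y:\mathsf{KAlgFrm_J}\to\mathsf{GPS}^{op}$ sends $L$ to the set $PP(L)$ of pseudoprime elements ($p\ne1$ such that $a_1\wedge\dots\wedge a_n\ll p$ implies $a_i\le p$ for some $i$) with the order of $L$, the subspace topology of the topology on $L$ generated by the sets ${\uparrow}k$ ($k\in K(L)$) and their complements, and with distinguished subset the set of (meet-)prime elements of $L$, and sends $\alpha$ to $R_\alpha$, where $pR_\alpha q$ iff $r(p)\le q$, $r$ being the right adjoint of $\alpha$. $\mathcal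 F$ and $\mathcal K$ are quasi-inverse equivalences between $\mathsf{BDMS}$ and $\mathsf{KAlgFrm_J}$; $\mathcal Y$ and $\mathcal V^a$ are quasi-inverse dual equivalences between $\mathsf{KAlgFrm_J}$ and $\mathsf{GPS}$; $\mathcal X$ and $\mathcal A$ are quasi-inverse dual equivalences between $\mathsf{BDMS}$ and $\mathsf{GPS}$ (generalized Priestley duality). Moreover, the optimal filters of $M\in\mathsf{BDMS}$ are exactly the pseudoprime elements of $\mathrm{Filt}(M)$, and $\mathcal X=\mathcal Y\circ\mathcal F$ and $\mathcal A=\mathcal K\circ\mathcal V^a$, in the sense that the identity maps on the underlying sets (for $\mathcal X$: the relations $P\subseteq F$) are natural isomorphisms. -/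

import Mathlib

open CategoryTheory Opposite Order

universe u

namespace GenPriestley

/-! ### Meet-semilattices

`SemilatInfCat` is the category of meet-semilattices with top; its morphisms preserve all finite
meets (including the top). -/

/-- A meet-semilattice is distributive if `a ⊓ b ≤ c` implies `c = a' ⊓ b'` for some `a' ≥ a` and
`b' ≥ b`. -/
def IsDistributiveMeetSemilattice (M : Type u) [SemilatticeInf M] : Prop :=
  ∀ a b c : M, a ⊓ b ≤ c → ∃ a' b' : M, a ≤ a' ∧ b ≤ b' ∧ a' ⊓ b' = c

/-- Distributive meet-semilattices that have a bottom element. -/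
def isBDMS : ObjectProperty SemilatInfCat.{u} := fun M =>
  IsDistributiveMeetSemilattice M ∧ ∃ b : M, ∀ a : M, b ≤ a

/-- Bounded distributive meet-semilattices, as a full subcategory of meet-semilattices (so the
morphisms preserve finite meets and the top, but need not preserve the bottom). -/
abbrev BDMS : Type (u + 1) := isBDMS.{u}.FullSubcategory

/-- The meet-semilattice homomorphism underlying a morphism. -/
abbrev BDMS.toHom {M N : BDMS.{u}} (f : M ⟶ N) : InfTopHom M.obj N.obj :=
  ConcreteCategory.hom f.hom

/-! ### Algebraic lattices and compact algebraic frames -/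

/-- Algebraic lattices. -/
structure AlgLat : Type (u + 1) where
  carrier : Type u
  [lattice : CompleteLattice carrier]
  [algebraic : IsCompactlyGenerated carrier]

attribute [instance] AlgLat.lattice AlgLat.algebraic

instance : CoeSort AlgLat.{u} (Type u) := ⟨AlgLat.carrier⟩

/-- Maps that preserve arbitrary joins and compact elements. -/
@[ext]
structure AlgLatHom (L M : Type u) [CompleteLattice L] [CompleteLattice M] where
  toFun : L → M
  map_sSup : ∀ S : Set L, toFun (sSup S) = sSup (toFun '' S)
  map_compact : ∀ k : L, IsCompactElement k → IsCompactElement (toFun k)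

instance : Category AlgLat.{u} where
  Hom L M := AlgLatHom L M
  id L := ⟨id, by simp, fun _ h => h⟩
  comp f g := ⟨g.toFun ∘ f.toFun, fun S => by
      simp only [Function.comp_apply, f.map_sSup, g.map_sSup, Set.image_image],
    fun k hk => g.map_compact _ (f.map_compact _ hk)⟩

/-- The map underlying a morphism of algebraic lattices. -/
def AlgLat.toHom {L M : AlgLat.{u}} (f : L ⟶ M) : AlgLatHom L M := f

/-- The join infinite distributive law. -/
def IsFrameLattice (L : Type u) [CompleteLattice L] : Prop :=
  ∀ (a : L) (S : Set L), a ⊓ sSup S = sSup ((fun s => a ⊓ s) '' S)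

/-- Algebraic lattices that are frames and have a compact top element. -/
def isKAlgFrm : ObjectProperty AlgLat.{u} := fun L =>
  IsFrameLattice L ∧ IsCompactElement (⊤ : L)

/-- Compact algebraic frames, as a full subcategory of algebraic lattices: the morphisms preserve
arbitrary joins and compact elements, but need not preserve finite meets. -/
abbrev KAlgFrmJ : Type (u + 1) := isKAlgFrm.{u}.FullSubcategory

/-- The map underlying a morphism of compact algebraic frames. -/
abbrev KAlgFrmJ.toHom {L M : KAlgFrmJ.{u}} (f : L ⟶ M) : AlgLatHom L.obj M.obj :=
  AlgLat.toHom f.hom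

/-! ### Generalized Priestley spaces -/

section Spaces

variable {X : Type u} [PartialOrder X] [TopologicalSpace X]

/-- Admissible clopen upsets, with respect to a subset `X₀`: the maximal elements of the complement
lie in `X₀`. -/
def IsAdmissible (X₀ : Set X) (U : Set X) : Prop :=
  IsClopen U ∧ IsUpperSet U ∧ {x | Maximal (· ∈ Uᶜ) x} ⊆ X₀

/-- Admissible closed upsets, with respect to a subset `X₀`. -/
def IsAdmissibleClosed (X₀ : Set X) (C : Set X) : Prop :=
  IsClosed C ∧ IsUpperSet C ∧ Cᶜ = {x | ∃ y ∈ X₀ \ C, x ≤ y}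

variable (X) in
/-- The axioms of a generalized Priestley space. -/
structure IsGPS (X₀ : Set X) : Prop where
  compact : CompactSpace X
  priestley : PriestleySpace X
  dense : Dense X₀
  order_dense : ∀ x : X, ∃ y ∈ X₀, x ≤ y
  mem_iff : ∀ x : X, x ∈ X₀ ↔ DirectedOn (· ⊆ ·) {U | IsAdmissible X₀ U ∧ x ∉ U}
  le_iff : ∀ x y : X, x ≤ y ↔ ∀ U, IsAdmissible X₀ U → x ∈ U → y ∈ U

end Spaces

/-- Generalized Priestley spaces. -/
structure GPS : Type (u + 1) where
  carrier : Type u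
  [order : PartialOrder carrier]
  [top : TopologicalSpace carrier]
  X₀ : Set carrier
  isGPS : IsGPS carrier X₀

attribute [instance] GPS.order GPS.top

instance : CoeSort GPS.{u} (Type u) := ⟨GPS.carrier⟩

/-- `box R U = {x | R[x] ⊆ U}`. -/
def box {X Y : Type u} (R : X → Y → Prop) (U : Set Y) : Set X := {x | ∀ y, R x y → y ∈ U}

/-- The two conditions on a generalized Priestley morphism. -/
structure IsGPMorphism {X Y : Type u} [PartialOrder X] [TopologicalSpace X] [PartialOrder Y]
    [TopologicalSpace Y] (X₀ : Set X) (Y₀ : Set Y) (R : X → Y → Prop) : Prop where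
  exists_of_not_rel : ∀ x y, ¬ R x y →
    ∃ U, IsAdmissible Y₀ U ∧ (∀ z, R x z → z ∈ U) ∧ y ∉ U
  box_admissible : ∀ U, IsAdmissible Y₀ U → IsAdmissible X₀ (box R U)

/-- Generalized Priestley morphisms. -/
@[ext]
structure GPSHom (X Y : GPS.{u}) where
  rel : X → Y → Prop
  isGPMorphism : IsGPMorphism X.X₀ Y.X₀ rel

/-- The composition `S * R` of `R ⊆ X × Y` and `S ⊆ Y × Z`, where `Z₀` is the distinguished subset
of `Z`. -/
def relComp {X Y Z : Type u} [PartialOrder Z] [TopologicalSpace Z] (Z₀ : Set Z)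
    (R : X → Y → Prop) (S : Y → Z → Prop) : X → Z → Prop :=
  fun x z => ∀ U, IsAdmissible Z₀ U → x ∈ box R (box S U) → z ∈ U

theorem box_relComp {X Y Z : Type u} [PartialOrder Z] [TopologicalSpace Z] (Z₀ : Set Z)
    (R : X → Y → Prop) (S : Y → Z → Prop) {U : Set Z} (hU : IsAdmissible Z₀ U) :
    box (relComp Z₀ R S) U = box R (box S U) := by
  ext x
  refine ⟨fun h y hy z hz => h z fun W _ hW => hW y hy z hz, fun h z hz => hz U hU h⟩

theorem box_le {X : Type u} [PartialOrder X] {U : Set X} (hU : IsUpperSet U) :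
    box (fun x y : X => x ≤ y) U = U := by
  ext x
  exact ⟨fun h => h x le_rfl, fun h y hy => hU hy h⟩

/-- Generalized Priestley spaces with generalized Priestley morphisms; the identity of `X` is its
order, and the composition of `R` followed by `S` is `S * R`. -/
instance : Category GPS.{u} where
  Hom X Y := GPSHom X Y
  id X :=
    { rel := fun x y => x ≤ y
      isGPMorphism :=
        { exists_of_not_rel := fun x y h => by
            rw [X.isGPS.le_iff] at h
            push Not at h
            obtain ⟨U, hU, hx, hy⟩ := h
            exact ⟨U, hU, fun z hz => hU.2.1 hz hx, hy⟩
          box_admissible := fun U hU => by rwa [box_le hU.2.1] } }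
  comp {X Y Z} R S :=
    { rel := relComp Z.X₀ R.rel S.rel
      isGPMorphism :=
        { exists_of_not_rel := fun x z h => by
            unfold relComp at h
            push Not at h
            obtain ⟨U, hU, hx, hz⟩ := h
            rw [← box_relComp Z.X₀ R.rel S.rel hU] at hx
            exact ⟨U, hU, hx, hz⟩
          box_admissible := fun U hU => by
            rw [box_relComp _ _ _ hU]
            exact R.isGPMorphism.box_admissible _ (S.isGPMorphism.box_admissible _ hU) } }
  id_comp {X Y} R := by
    apply GPSHom.ext
    funext x y
    refine propext ⟨fun h => ?_, fun h U hU hx => hx x le_rfl y h⟩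
    by_contra hn
    obtain ⟨U, hU, hx, hy⟩ := R.isGPMorphism.exists_of_not_rel x y hn
    refine hy (h U hU ?_)
    rw [box_le (R.isGPMorphism.box_admissible U hU).2.1]
    exact hx
  comp_id {X Y} R := by
    apply GPSHom.ext
    funext x y
    refine propext ⟨fun h => ?_, fun h U hU hx => hx y h y le_rfl⟩
    by_contra hn
    obtain ⟨U, hU, hx, hy⟩ := R.isGPMorphism.exists_of_not_rel x y hn
    refine hy (h U hU ?_)
    rw [box_le hU.2.1]
    exact hx
  assoc {W X Y Z} R S T := by
    apply GPSHom.ext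
    funext x z
    refine propext (forall₂_congr fun U hU => ?_)
    rw [box_relComp _ _ _ (T.isGPMorphism.box_admissible U hU), box_relComp _ _ _ hU]

/-- The generalized Priestley morphism underlying a morphism of generalized Priestley spaces. -/
def GPS.toHom {X Y : GPS.{u}} (f : X ⟶ Y) : GPSHom X Y := f

/-! ### The filter functor -/

section Filters

variable {M N : Type u} [SemilatticeInf M] [OrderTop M] [SemilatticeInf N] [OrderTop N]

/-- The intersection of a family of filters. -/
instance : InfSet (PFilter M) where
  sInf S := (IsPFilter.of_def (F := {a : M | ∀ F ∈ S, a ∈ F}) ⟨⊤, fun _ _ => PFilter.top_mem⟩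
    (fun a ha b hb => ⟨a ⊓ b, fun F hF => PFilter.inf_mem (ha F hF) (hb F hF),
      inf_le_left, inf_le_right⟩)
    (fun hab ha F hF => PFilter.mem_of_le hab (ha F hF))).toPFilter

/-- Filters ordered by inclusion form a complete lattice, with intersections as meets. -/
instance : CompleteLattice (PFilter M) :=
  completeLatticeOfInf (PFilter M) fun _ =>
    ⟨fun _ hF _ ha => ha _ hF, fun _ hG _ ha F hF => hG hF ha⟩

/-- The filter `↑α[F]` generated by the image of a filter `F`. -/
def filterMap (α : InfTopHom M N) (F : PFilter M) : PFilter N :=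
  (IsPFilter.of_def (F := {b : N | ∃ a ∈ F, α a ≤ b}) ⟨⊤, ⊤, PFilter.top_mem, le_top⟩
    (fun b ⟨a, ha, hab⟩ b' ⟨a', ha', hab'⟩ =>
      ⟨b ⊓ b', ⟨a ⊓ a', PFilter.inf_mem ha ha', by
        rw [map_inf]; exact inf_le_inf hab hab'⟩, inf_le_left, inf_le_right⟩)
    (fun hbb' ⟨a, ha, hab⟩ => ⟨a, ha, hab.trans hbb'⟩)).toPFilter

theorem mem_filterMap {α : InfTopHom M N} {F : PFilter M} {b : N} :
    b ∈ filterMap α F ↔ ∃ a ∈ F, α a ≤ b := Iff.rfl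

end Filters

/-- `M ↦ Filt(M)`, `α ↦ (F ↦ ↑α[F])` takes values in compact algebraic frames. -/
structure FilterWellDefined : Prop where
  algebraic : ∀ M : BDMS.{u}, IsCompactlyGenerated (PFilter M.obj)
  isKAlgFrm : ∀ M : BDMS.{u}, isKAlgFrm (@AlgLat.mk (PFilter M.obj) _ (algebraic M))
  map_sSup : ∀ {M N : BDMS.{u}} (α : M ⟶ N) (S : Set (PFilter M.obj)),
    filterMap (BDMS.toHom α) (sSup S) = sSup (filterMap (BDMS.toHom α) '' S)
  map_compact : ∀ {M N : BDMS.{u}} (α : M ⟶ N) (F : PFilter M.obj),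
    IsCompactElement F → IsCompactElement (filterMap (BDMS.toHom α) F)

/-- The functor `ℱ`. -/
def filterFunctor (h : FilterWellDefined.{u}) : BDMS.{u} ⥤ KAlgFrmJ.{u} where
  obj M := ⟨@AlgLat.mk (PFilter M.obj) _ (h.algebraic M), h.isKAlgFrm M⟩
  map α := ⟨⟨filterMap (BDMS.toHom α), h.map_sSup α, h.map_compact α⟩⟩
  map_id M := by
    apply InducedCategory.hom_ext
    apply AlgLatHom.ext
    funext F
    apply SetLike.ext
    intro b
    exact ⟨fun ⟨a, ha, hab⟩ => PFilter.mem_of_le hab ha, fun hb => ⟨b, hb, le_rfl⟩⟩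
  map_comp {M N K} α β := by
    apply InducedCategory.hom_ext
    apply AlgLatHom.ext
    funext F
    apply SetLike.ext
    intro c
    refine ⟨fun ⟨a, ha, hac⟩ => ⟨BDMS.toHom α a, ⟨a, ha, le_rfl⟩, hac⟩, ?_⟩
    rintro ⟨b, ⟨a, ha, hab⟩, hbc⟩
    exact ⟨a, ha, (OrderHomClass.mono (BDMS.toHom β) hab).trans hbc⟩

/-! ### The compact element functor -/

section Compacts

variable (L : Type u) [CompleteLattice L]

/-- Compact elements, with the dual of the order of `L`. -/
abbrev CompactsDual : Type u := {k : L // IsCompactElement k}ᵒᵈ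

variable {L}

theorem isCompactElement_bot' : IsCompactElement (⊥ : L) :=
  fun _ _ ⟨x, hx⟩ _ _ _ => ⟨x, hx, bot_le⟩

theorem isCompactElement_sup' {k l : L} (hk : IsCompactElement k) (hl : IsCompactElement l) :
    IsCompactElement (k ⊔ l) := by
  intro s u hs hd hu hle
  obtain ⟨x, hx, hkx⟩ := hk s u hs hd hu (le_sup_left.trans hle)
  obtain ⟨y, hy, hly⟩ := hl s u hs hd hu (le_sup_right.trans hle)
  obtain ⟨z, hz, hxz, hyz⟩ := hd x hx y hy
  exact ⟨z, hz, sup_le (hkx.trans hxz) (hly.trans hyz)⟩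

/-- Binary joins of compact elements. -/
instance : SemilatticeSup {k : L // IsCompactElement k} :=
  Subtype.semilatticeSup fun _ _ hk hl => isCompactElement_sup' hk hl

instance : OrderBot {k : L // IsCompactElement k} where
  bot := ⟨⊥, isCompactElement_bot'⟩
  bot_le k := (bot_le : (⊥ : L) ≤ k.1)

/-- The restriction of a map to compact elements. -/
def compactMap {M : Type u} [CompleteLattice M] (α : AlgLatHom L M) :
    InfTopHom (CompactsDual L) (CompactsDual M) where
  toFun k := OrderDual.toDual ⟨α.toFun (OrderDual.ofDual k).1, α.map_compact _ k.2⟩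
  map_inf' k l := by
    apply Subtype.ext
    change α.toFun (k.1 ⊔ l.1) = α.toFun k.1 ⊔ α.toFun l.1
    rw [← sSup_pair, α.map_sSup, Set.image_pair, sSup_pair]
  map_top' := by
    apply Subtype.ext
    change α.toFun ⊥ = ⊥
    rw [← sSup_empty, α.map_sSup, Set.image_empty, sSup_empty]

end Compacts

/-- `L ↦ (K(L), ≥)` takes values in bounded distributive meet-semilattices. -/
def CompactWellDefined : Prop :=
  ∀ L : KAlgFrmJ.{u}, isBDMS (SemilatInfCat.of (CompactsDual L.obj))

/-- The functor `𝒦`, which restricts a morphism to the compact elements. -/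
def compactFunctor (h : CompactWellDefined.{u}) : KAlgFrmJ.{u} ⥤ BDMS.{u} where
  obj L := ⟨SemilatInfCat.of (CompactsDual L.obj), h L⟩
  map α := ⟨ConcreteCategory.ofHom (C := SemilatInfCat) (compactMap (KAlgFrmJ.toHom α))⟩
  map_id _ := rfl
  map_comp _ _ := rfl

/-! ### The functor of admissible clopen upsets -/

section AdmissibleClopen

variable {X : Type u} [PartialOrder X] [TopologicalSpace X]

theorem IsAdmissible.inter {X₀ U V : Set X} (hU : IsAdmissible X₀ U) (hV : IsAdmissible X₀ V) :
    IsAdmissible X₀ (U ∩ V) := by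
  refine ⟨hU.1.inter hV.1, hU.2.1.inter hV.2.1, fun x hx => ?_⟩
  by_cases hxU : x ∈ U
  · have hxV : x ∉ V := fun h => hx.1 ⟨hxU, h⟩
    exact hV.2.2 ⟨hxV, fun y hy hxy => hx.2 (fun h => hy h.2) hxy⟩
  · exact hU.2.2 ⟨hxU, fun y hy hxy => hx.2 (fun h => hy h.1) hxy⟩

theorem IsAdmissible.univ {X₀ : Set X} : IsAdmissible X₀ (Set.univ : Set X) :=
  ⟨isClopen_univ, isUpperSet_univ, fun x hx => (hx.1 (Set.mem_univ x)).elim⟩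

end AdmissibleClopen

/-- The admissible clopen upsets of `X`, ordered by inclusion. -/
abbrev Adm (X : GPS.{u}) : Type u := {U : Set X // IsAdmissible X.X₀ U}

/-- Finite meets are intersections. -/
instance (X : GPS.{u}) : SemilatticeInf (Adm X) :=
  Subtype.semilatticeInf fun _ _ hU hV => IsAdmissible.inter hU hV

instance (X : GPS.{u}) : OrderTop (Adm X) where
  top := ⟨Set.univ, IsAdmissible.univ⟩
  le_top U := Set.subset_univ U.1

/-- `box R` on admissible clopen upsets. -/
def admMap {X Y : GPS.{u}} (R : GPSHom X Y) : InfTopHom (Adm Y) (Adm X) where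
  toFun U := ⟨box R.rel U.1, R.isGPMorphism.box_admissible _ U.2⟩
  map_inf' U V := by
    apply Subtype.ext
    ext x
    exact ⟨fun h => ⟨fun y hy => (h y hy).1, fun y hy => (h y hy).2⟩,
      fun h y hy => ⟨h.1 y hy, h.2 y hy⟩⟩
  map_top' := by
    apply Subtype.ext
    ext x
    exact ⟨fun _ => Set.mem_univ x, fun _ y _ => Set.mem_univ y⟩

/-- `X ↦ 𝒜(X)` takes values in bounded distributive meet-semilattices. -/
def AdmWellDefined : Prop :=
  ∀ X : GPS.{u}, isBDMS (SemilatInfCat.of (Adm X))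

/-- The contravariant functor `𝒜`, which sends `R` to `box R`. -/
def admFunctor (h : AdmWellDefined.{u}) : GPS.{u}ᵒᵖ ⥤ BDMS.{u} where
  obj X := ⟨SemilatInfCat.of (Adm X.unop), h X.unop⟩
  map R := ⟨ConcreteCategory.ofHom (C := SemilatInfCat) (admMap (GPS.toHom R.unop))⟩
  map_id X := by
    apply InducedCategory.hom_ext
    apply InfTopHom.ext
    intro U
    apply Subtype.ext
    exact box_le U.2.2.1
  map_comp R S := by
    apply InducedCategory.hom_ext
    apply InfTopHom.ext
    intro U
    apply Subtype.ext
    exact box_relComp _ _ _ U.2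

/-! ### The functor of admissible closed upsets -/

/-- The admissible closed upsets of `X`, ordered by reverse inclusion. -/
@[ext]
structure ClosedAdm (X : GPS.{u}) : Type u where
  val : Set X
  property : IsAdmissibleClosed X.X₀ val

instance (X : GPS.{u}) : PartialOrder (ClosedAdm X) where
  le C D := D.1 ⊆ C.val
  le_refl _ := subset_rfl
  le_trans _ _ _ h h' := h'.trans h
  le_antisymm _ _ h h' := ClosedAdm.ext (h'.antisymm h)

/-- Joins are intersections. -/
instance (X : GPS.{u}) : SupSet (ClosedAdm X) where
  sSup S := ⟨⋂ C ∈ S, C.val, isClosed_biInter fun C _ => C.property.1,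
    isUpperSet_iInter₂ fun C _ => C.property.2.1, by
      ext x
      constructor
      · intro hx
        simp only [Set.mem_compl_iff, Set.mem_iInter, not_forall] at hx
        obtain ⟨C, hC, hxC⟩ := hx
        have hx' : x ∈ C.valᶜ := hxC
        rw [C.2.2.2] at hx'
        obtain ⟨y, hy, hxy⟩ := hx'
        exact ⟨y, ⟨hy.1, fun h => hy.2 (Set.mem_iInter₂.1 h C hC)⟩, hxy⟩
      · rintro ⟨y, hy, hxy⟩ hx
        exact hy.2 (isUpperSet_iInter₂ (fun C (_ : C ∈ S) => C.2.2.1) hxy hx)⟩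

instance (X : GPS.{u}) : CompleteLattice (ClosedAdm X) :=
  completeLatticeOfSup (ClosedAdm X) fun _ =>
    ⟨fun _ hC _ hx => Set.mem_iInter₂.1 hx _ hC,
      fun _ hD _ hx => Set.mem_iInter₂.2 fun C hC => hD hC hx⟩

/-- `X ↦ (𝒱ᵃ(X), ⊇)`, `R ↦ box R` is contravariantly functorial, with values in compact algebraic
frames. -/
structure VietorisWellDefined : Prop where
  algebraic : ∀ X : GPS.{u}, IsCompactlyGenerated (ClosedAdm X)
  isKAlgFrm : ∀ X : GPS.{u}, isKAlgFrm (@AlgLat.mk (ClosedAdm X) _ (algebraic X))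
  box_mem : ∀ {X Y : GPS.{u}} (R : GPSHom X Y) (C : ClosedAdm Y),
    IsAdmissibleClosed X.X₀ (box R.rel C.val)
  map_sSup : ∀ {X Y : GPS.{u}} (R : GPSHom X Y) (S : Set (ClosedAdm Y)),
    (⟨box R.rel (sSup S).1, box_mem R _⟩ : ClosedAdm X) =
      sSup ((fun C => ⟨box R.rel C.val, box_mem R C⟩) '' S)
  map_compact : ∀ {X Y : GPS.{u}} (R : GPSHom X Y) (C : ClosedAdm Y),
    IsCompactElement C → IsCompactElement (⟨box R.rel C.val, box_mem R C⟩ : ClosedAdm X)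
  map_comp : ∀ {X Y Z : GPS.{u}} (R : GPSHom X Y) (S : GPSHom Y Z) (C : ClosedAdm Z),
    box (relComp Z.X₀ R.rel S.rel) C.val = box R.rel (box S.rel C.val)

/-- The contravariant functor `𝒱ᵃ`. -/
def vietorisFunctor (h : VietorisWellDefined.{u}) : GPS.{u}ᵒᵖ ⥤ KAlgFrmJ.{u} where
  obj X := ⟨@AlgLat.mk (ClosedAdm X.unop) _ (h.algebraic X.unop), h.isKAlgFrm X.unop⟩
  map R := ⟨⟨fun C => ⟨box (GPS.toHom R.unop).rel C.val, h.box_mem (GPS.toHom R.unop) C⟩,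
    h.map_sSup (GPS.toHom R.unop), h.map_compact (GPS.toHom R.unop)⟩⟩
  map_id X := by
    apply InducedCategory.hom_ext
    apply AlgLatHom.ext
    funext C
    exact ClosedAdm.ext (box_le C.2.2.1)
  map_comp R S := by
    apply InducedCategory.hom_ext
    apply AlgLatHom.ext
    funext C
    exact ClosedAdm.ext (h.map_comp (GPS.toHom S.unop) (GPS.toHom R.unop) C)

/-! ### The functor of optimal filters -/

section Optimal

/-- The map `f` preserves all finite joins that exist (including the empty one). -/
def PreservesExistingFiniteJoins {M N : Type u} [Preorder M] [Preorder N] (f : M → N) : Prop :=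
  ∀ (s : Finset M) (a : M), IsLUB (s : Set M) a → IsLUB (f '' (s : Set M)) (f a)

/-- `D`, together with `e : M → D`, is the distributive envelope of `M`: the reflection of `M` from
meet-semilattices, with maps preserving finite meets and existing finite joins, into bounded
distributive lattices. -/
structure IsDistributiveEnvelope {M D : Type u} [SemilatticeInf M] [OrderTop M] [DistribLattice D]
    [BoundedOrder D] (e : InfTopHom M D) : Prop where
  preserves : PreservesExistingFiniteJoins e
  existsUnique : ∀ (E : Type u) [DistribLattice E] [BoundedOrder E] (f : InfTopHom M E),
    PreservesExistingFiniteJoins f → ∃! g : BoundedLatticeHom D E, ∀ a, g (e a) = f a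

variable {M : Type u} [SemilatticeInf M] [OrderTop M]

/-- Prime filters: proper filters `P` such that `F₁ ∩ F₂ ⊆ P` implies `F₁ ⊆ P` or `F₂ ⊆ P`. -/
def IsPrimeFilter (P : PFilter M) : Prop :=
  (∃ a : M, a ∉ P) ∧
    ∀ F₁ F₂ : PFilter M, (F₁ : Set M) ∩ (F₂ : Set M) ⊆ (P : Set M) → F₁ ≤ P ∨ F₂ ≤ P

/-- Optimal filters: the restrictions to `M` of the prime filters of the distributive envelope. -/
def IsOptimal (F : PFilter M) : Prop :=
  ∃ (D : Type u) (_ : DistribLattice D) (_ : BoundedOrder D) (e : InfTopHom M D),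
    IsDistributiveEnvelope e ∧ ∃ P : PFilter D, P.IsPrime ∧ ∀ a : M, a ∈ F ↔ e a ∈ P

variable (M)

/-- The set of optimal filters, ordered by inclusion. -/
abbrev Opt : Type u := {F : PFilter M // IsOptimal F}

/-- The topology generated by the sets `φ(a) = {x | a ∈ x}` and their complements. -/
instance : TopologicalSpace (Opt M) :=
  TopologicalSpace.generateFrom
    ({U | ∃ a : M, U = {x : Opt M | a ∈ x.1}} ∪ {U | ∃ a : M, U = {x : Opt M | a ∈ x.1}ᶜ})

/-- The prime filters, as a subset of the optimal filters. -/
def Opt.primes : Set (Opt M) := {x | IsPrimeFilter x.1}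

variable {M} {N : Type u} [SemilatticeInf N] [OrderTop N]

/-- `x R_α y` iff `α⁻¹(x) ⊆ y`. -/
def optRel (α : InfTopHom M N) : Opt N → Opt M → Prop :=
  fun x y => ∀ a : M, α a ∈ x.1 → a ∈ y.1

end Optimal

/-- `M ↦ ⟨Opt(M), τ, ⊆, Pr(M)⟩`, `α ↦ R_α` is contravariantly functorial, with values in generalized
Priestley spaces. -/
structure OptWellDefined : Prop where
  isGPS : ∀ M : BDMS.{u}, IsGPS (Opt M.obj) (Opt.primes M.obj)
  isGPMorphism : ∀ {M N : BDMS.{u}} (α : M ⟶ N),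
    IsGPMorphism (Opt.primes N.obj) (Opt.primes M.obj) (optRel (BDMS.toHom α))
  map_comp : ∀ {M N K : BDMS.{u}} (α : M ⟶ N) (β : N ⟶ K),
    optRel (BDMS.toHom (α ≫ β)) =
      relComp (Opt.primes M.obj) (optRel (BDMS.toHom β)) (optRel (BDMS.toHom α))

/-- The contravariant functor `𝒳`. -/
def optFunctor (h : OptWellDefined.{u}) : BDMS.{u} ⥤ GPS.{u}ᵒᵖ where
  obj M := op ⟨Opt M.obj, Opt.primes M.obj, h.isGPS M⟩
  map α := Quiver.Hom.op (V := GPS.{u}) ⟨optRel (BDMS.toHom α), h.isGPMorphism α⟩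
  map_id M := rfl
  map_comp α β := by
    apply Quiver.Hom.unop_inj
    apply GPSHom.ext
    exact h.map_comp α β

/-! ### The functor of pseudoprime elements -/

section Pseudoprime

variable (L : Type u) [CompleteLattice L]

variable {L} in
/-- The way below relation. -/
def WayBelow (a b : L) : Prop :=
  ∀ S : Set L, b ≤ sSup S → ∃ T : Finset L, (T : Set L) ⊆ S ∧ a ≤ sSup (T : Set L)

variable {L} in
/-- Pseudoprime elements: `p ≠ ⊤`, and whenever a finite meet is way below `p`, one of its members
is below `p`. -/
def IsPseudoprime (p : L) : Prop :=
  p ≠ ⊤ ∧ ∀ s : Finset L, WayBelow (s.inf id) p → ∃ a ∈ s, a ≤ p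

/-- The topology on an algebraic lattice generated by the sets `↑k` and their complements, for `k`
compact. -/
abbrev compactTopology : TopologicalSpace L :=
  TopologicalSpace.generateFrom
    ({U | ∃ k : L, IsCompactElement k ∧ U = Set.Ici k} ∪
      {U | ∃ k : L, IsCompactElement k ∧ U = (Set.Ici k)ᶜ})

/-- The set of pseudoprime elements, with the order of `L`. -/
abbrev PP : Type u := {p : L // IsPseudoprime p}

/-- The subspace topology. -/
instance : TopologicalSpace (PP L) :=
  TopologicalSpace.induced Subtype.val (compactTopology L)

/-- The (meet-)prime elements, as a subset of the pseudoprime elements. -/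
def PP.primes : Set (PP L) := {p | InfPrime p.1}

variable {L} {M : Type u} [CompleteLattice M]

/-- The right adjoint of a join-preserving map. -/
def rightAdj (α : AlgLatHom L M) (p : M) : L := sSup {a | α.toFun a ≤ p}

theorem gc_rightAdj (α : AlgLatHom L M) : GaloisConnection α.toFun (rightAdj α) := by
  intro a p
  refine ⟨fun h => le_sSup h, fun h => ?_⟩
  have hmono : α.toFun a ≤ α.toFun (rightAdj α p) := by
    have h2 := α.map_sSup {a, rightAdj α p}
    rw [Set.image_pair, sSup_pair, sSup_pair, sup_eq_right.2 h] at h2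
    rw [h2]
    exact le_sup_left
  refine hmono.trans ?_
  rw [rightAdj, α.map_sSup]
  apply sSup_le
  rintro _ ⟨b, hb, rfl⟩
  exact hb

/-- `p R_α q` iff `r(p) ≤ q`, where `r` is the right adjoint of `α`. -/
def ppRel (α : AlgLatHom L M) : PP M → PP L → Prop := fun p q => rightAdj α p.1 ≤ q.1

end Pseudoprime

/-- `L ↦ ⟨PP(L), τ, ≤, P(L)⟩`, `α ↦ R_α` is contravariantly functorial, with values in generalized
Priestley spaces. -/
structure PPWellDefined : Prop where
  isGPS : ∀ L : KAlgFrmJ.{u}, IsGPS (PP L.obj) (PP.primes L.obj)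
  isGPMorphism : ∀ {L M : KAlgFrmJ.{u}} (α : L ⟶ M),
    IsGPMorphism (PP.primes M.obj) (PP.primes L.obj) (ppRel (KAlgFrmJ.toHom α))
  map_comp : ∀ {L M N : KAlgFrmJ.{u}} (α : L ⟶ M) (β : M ⟶ N),
    ppRel (KAlgFrmJ.toHom (α ≫ β)) =
      relComp (PP.primes L.obj) (ppRel (KAlgFrmJ.toHom β)) (ppRel (KAlgFrmJ.toHom α))

/-- The contravariant functor `𝒴`. -/
def ppFunctor (h : PPWellDefined.{u}) : KAlgFrmJ.{u} ⥤ GPS.{u}ᵒᵖ where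
  obj L := op ⟨PP L.obj, PP.primes L.obj, h.isGPS L⟩
  map α := Quiver.Hom.op (V := GPS.{u}) ⟨ppRel (KAlgFrmJ.toHom α), h.isGPMorphism α⟩
  map_id L := by
    apply Quiver.Hom.unop_inj
    apply GPSHom.ext
    funext p q
    have : rightAdj (KAlgFrmJ.toHom (𝟙 L)) p.1 = p.1 :=
      le_antisymm (sSup_le fun _ h => h) (le_sSup (le_refl p.1))
    exact congrArg (· ≤ q.1) this
  map_comp α β := by
    apply Quiver.Hom.unop_inj
    apply GPSHom.ext
    exact h.map_comp α β

end GenPriestley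

open GenPriestley

/-!
`Filt(M)` is algebraic with compact elements the principal filters, whence `ℱ` and `𝒦` are
quasi-inverse. For the duality with spaces the key fact is that the admissible clopen upsets of
`PP(L)` are exactly the sets `φ(k) = {p | k ≤ p}` with `k` compact. By compactness of `PP(L)`, an
admissible `U` is a finite union of sets `φ(kᵢ)`; as the maximal elements of its complement are
prime, `U` is all of `φ(⋀ kᵢ)`, and compactness, once more, replaces `⋀ kᵢ` by a compact element.
Hence `𝒦 ≅ 𝒜 ∘ 𝒴`. A generalized Priestley morphism is determined by its action on admissible
upsets, and every meet-preserving map `𝒜(Y) → 𝒜(X)` comes from one, so `𝒜` is fully faithful; so is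
`𝒱ᵃ`, because `𝒜 ≅ 𝒦 ∘ 𝒱ᵃ` (a closed admissible upset is the intersection of the admissible upsets
containing it). A fully faithful functor with a right inverse is an equivalence, which gives both
dualities once optimal filters are recognized as the pseudoprime elements of `Filt(M)`: the
distributive envelope is realized by sets of primes of `Filt(M)`, and by the prime ideal theorem `F`
is optimal iff, whenever `a ∈ F` lies below every upper bound of a finite set `s`, some member of
`s` is in `F`.
-/

namespace GenPriestley

/-! ### Compact elements -/

section CompactElements

variable {L : Type*} [CompleteLattice L]

theorem isCompactElement_orderIso {M : Type*} [CompleteLattice M] (e : L ≃o M) {k : L}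
    (hk : IsCompactElement k) : IsCompactElement (e k) := by
  intro s v hs hd hv hle
  obtain ⟨_, ⟨y, hy, rfl⟩, hky⟩ := hk (e.symm '' s) (e.symm v) (hs.image _)
    (hd.mono_comp fun _ _ h => e.symm.monotone h) ((OrderIso.isLUB_image' e.symm).2 hv)
    (e.le_symm_apply.2 hle)
  exact ⟨y, hy, e.le_symm_apply.1 hky⟩

theorem mem_of_isCompactElement_of_isLUB {S : Set L} {k : L} (hk : IsCompactElement k)
    (hS : S.Nonempty) (hd : DirectedOn (· ≤ ·) S) (h : IsLUB S k) : k ∈ S := by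
  obtain ⟨x, hx, hkx⟩ := hk S k hS hd h le_rfl
  rwa [hkx.antisymm (h.1 hx)]

theorem directedOn_compact_le (b : L) : DirectedOn (· ≤ ·) {c : L | IsCompactElement c ∧ c ≤ b} :=
  fun x hx y hy => ⟨x ⊔ y, ⟨isCompactElement_sup' hx.1 hy.1, sup_le hx.2 hy.2⟩,
    le_sup_left, le_sup_right⟩

theorem compact_le_nonempty (b : L) : {c : L | IsCompactElement c ∧ c ≤ b}.Nonempty :=
  ⟨⊥, isCompactElement_bot', bot_le⟩

theorem exists_compact_of_not_le [IsCompactlyGenerated L] {a b : L} (h : ¬ a ≤ b) :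
    ∃ k, IsCompactElement k ∧ k ≤ a ∧ ¬ k ≤ b := by
  rw [le_iff_compact_le_imp] at h
  push Not at h
  exact h

theorem exists_compact_le_map [IsCompactlyGenerated L] {M : Type*} [CompleteLattice M] {f : L → M}
    (hf : ScottContinuous f) {c : M} (hc : IsCompactElement c) {x : L} (h : c ≤ f x) :
    ∃ k, IsCompactElement k ∧ k ≤ x ∧ c ≤ f k := by
  have hd := directedOn_compact_le x
  have hlub := hf (compact_le_nonempty x) hd (isLUB_iff_sSup_eq.2 (sSup_compact_le_eq x))
  obtain ⟨_, ⟨k, hk, rfl⟩, hck⟩ := hc _ _ ((compact_le_nonempty x).image f)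
    (hd.mono_comp fun _ _ h => hf.monotone h) hlub h
  exact ⟨k, hk.1, hk.2, hck⟩

end CompactElements

theorem scottContinuous_sup_right {L : Type*} [SemilatticeSup L] (y : L) :
    ScottContinuous fun x => x ⊔ y := by
  intro S hS _ a ha
  refine ⟨?_, fun b hb => ?_⟩
  · rintro _ ⟨x, hx, rfl⟩
    exact sup_le_sup_right (ha.1 hx) y
  · have hb' : ∀ x ∈ S, x ⊔ y ≤ b := fun x hx => hb ⟨x, hx, rfl⟩
    obtain ⟨x₀, hx₀⟩ := hS
    exact sup_le (ha.2 fun x hx => le_sup_left.trans (hb' x hx)) (le_sup_right.trans (hb' x₀ hx₀))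

theorem AlgLatHom.scottContinuous {L M : Type u} [CompleteLattice L] [CompleteLattice M]
    (α : AlgLatHom L M) : ScottContinuous α.toFun :=
  fun _ _ _ _ ha => (gc_rightAdj α).isLUB_l_image ha

/-- A complete lattice with the join infinite distributive law, as a frame in the sense of
Mathlib. -/
abbrev IsFrameLattice.toFrame {L : Type u} [CompleteLattice L] (hL : IsFrameLattice L) :
    Order.Frame L :=
  .ofMinimalAxioms ⟨fun a S => by rw [hL a S, sSup_image]⟩

theorem IsFrameLattice.inf_sup_left {L : Type u} [CompleteLattice L] (hL : IsFrameLattice L)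
    (a b c : L) : a ⊓ (b ⊔ c) = a ⊓ b ⊔ a ⊓ c :=
  letI := hL.toFrame
  _root_.inf_sup_left a b c

/-! ### Isomorphisms from order isomorphisms -/

/-- The morphism underlying an order isomorphism. -/
def AlgLatHom.ofOrderIso {L M : Type u} [CompleteLattice L] [CompleteLattice M] (e : L ≃o M) :
    AlgLatHom L M where
  toFun := e
  map_sSup S := by rw [e.map_sSup, sSup_image]
  map_compact _ hk := isCompactElement_orderIso e hk

/-- The isomorphism of compact algebraic frames given by an order isomorphism. -/
def KAlgFrmJ.isoMk {L M : KAlgFrmJ.{u}} (e : L.obj ≃o M.obj) : L ≅ M where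
  hom := ⟨AlgLatHom.ofOrderIso e⟩
  inv := ⟨AlgLatHom.ofOrderIso e.symm⟩
  hom_inv_id := by
    apply InducedCategory.hom_ext
    apply AlgLatHom.ext
    funext x
    exact e.symm_apply_apply x
  inv_hom_id := by
    apply InducedCategory.hom_ext
    apply AlgLatHom.ext
    funext x
    exact e.apply_symm_apply x

/-- The isomorphism of bounded distributive meet-semilattices given by an order isomorphism. -/
def BDMS.isoMk {M N : BDMS.{u}} (e : M.obj ≃o N.obj) : M ≅ N :=
  isBDMS.isoMk (SemilatInfCat.Iso.mk e)

/-! ### The lattice of filters -/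

section PrincipalFilters

variable {M : Type*} [SemilatticeInf M]

theorem isLUB_principal_image (F : PFilter M) : IsLUB (PFilter.principal '' (F : Set M)) F :=
  ⟨Set.forall_mem_image.2 fun _ ha => PFilter.principal_le_iff.2 ha,
    fun _ hG _ ha => PFilter.principal_le_iff.1 (hG (Set.mem_image_of_mem _ ha))⟩

theorem directedOn_principal_image (F : PFilter M) :
    DirectedOn (· ≤ ·) (PFilter.principal '' (F : Set M)) := by
  rintro _ ⟨a, ha, rfl⟩ _ ⟨b, hb, rfl⟩
  exact ⟨_, ⟨a ⊓ b, PFilter.inf_mem ha hb, rfl⟩, PFilter.antitone_principal inf_le_left,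
    PFilter.antitone_principal inf_le_right⟩

end PrincipalFilters

section FilterLattice

variable {M N : Type u} [SemilatticeInf M] [OrderTop M] [SemilatticeInf N] [OrderTop N]

theorem mem_pfilter_inf {F G : PFilter M} {a : M} : a ∈ F ⊓ G ↔ a ∈ F ∧ a ∈ G :=
  ⟨fun h => ⟨h F (Or.inl rfl), h G (Or.inr rfl)⟩, fun h H hH => by
    rcases hH with rfl | rfl
    exacts [h.1, h.2]⟩

/-- The Heyting implication `F ⇨ G` in the lattice of filters of a distributive meet-semilattice:
distributivity is what makes it closed under meets. -/
def filterHimp (hM : IsDistributiveMeetSemilattice M) (F G : PFilter M) : PFilter M :=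
  (IsPFilter.of_def (F := {c : M | ∀ d, c ≤ d → d ∈ F → d ∈ G})
    ⟨⊤, fun _ hd _ => top_le_iff.1 hd ▸ PFilter.top_mem⟩
    (fun c hc c' hc' => ⟨c ⊓ c', fun d hd hdF => by
      obtain ⟨d₁, d₂, h₁, h₂, rfl⟩ := hM _ _ _ hd
      exact PFilter.inf_mem (hc d₁ h₁ (PFilter.mem_of_le inf_le_left hdF))
        (hc' d₂ h₂ (PFilter.mem_of_le inf_le_right hdF)), inf_le_left, inf_le_right⟩)
    (fun hcc' hc d hd hdF => hc d (hcc'.trans hd) hdF)).toPFilter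

theorem gc_inf_filterHimp (hM : IsDistributiveMeetSemilattice M) (F : PFilter M) :
    GaloisConnection (F ⊓ ·) (filterHimp hM F) := fun _ _ =>
  ⟨fun h _ hc _ hcd hdF => h (mem_pfilter_inf.2 ⟨hdF, PFilter.mem_of_le hcd hc⟩),
    fun h d hd => h (mem_pfilter_inf.1 hd).2 d le_rfl (mem_pfilter_inf.1 hd).1⟩

theorem isFrameLattice_pfilter (hM : IsDistributiveMeetSemilattice M) :
    IsFrameLattice (PFilter M) := fun F S => by
  rw [(gc_inf_filterHimp hM F).l_sSup, sSup_image]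

/-- The union of a directed family of filters. -/
def filterUnion (S : Set (PFilter M)) (hS : S.Nonempty) (hd : DirectedOn (· ≤ ·) S) : PFilter M :=
  (IsPFilter.of_def (F := {c : M | ∃ F ∈ S, c ∈ F})
    (hS.elim fun F hF => ⟨⊤, F, hF, PFilter.top_mem⟩)
    (fun c ⟨F, hF, hc⟩ c' ⟨F', hF', hc'⟩ => by
      obtain ⟨H, hH, h, h'⟩ := hd F hF F' hF'
      exact ⟨c ⊓ c', ⟨H, hH, PFilter.inf_mem (h hc) (h' hc')⟩, inf_le_left, inf_le_right⟩)
    (fun hcc' ⟨F, hF, hc⟩ => ⟨F, hF, PFilter.mem_of_le hcc' hc⟩)).toPFilter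

theorem exists_mem_of_mem_isLUB {S : Set (PFilter M)} (hS : S.Nonempty)
    (hd : DirectedOn (· ≤ ·) S) {G : PFilter M} (hG : IsLUB S G) {a : M} (ha : a ∈ G) :
    ∃ F ∈ S, a ∈ F :=
  have h : G ≤ filterUnion S hS hd := hG.2 fun F hF _ hc => ⟨F, hF, hc⟩
  h ha

theorem isCompactElement_principal (a : M) : IsCompactElement (PFilter.principal a) := by
  intro S G hS hd hG hle
  obtain ⟨F, hF, ha⟩ := exists_mem_of_mem_isLUB hS hd hG (PFilter.principal_le_iff.1 hle)
  exact ⟨F, hF, PFilter.principal_le_iff.2 ha⟩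

theorem isCompactElement_pfilter_iff {F : PFilter M} :
    IsCompactElement F ↔ ∃ a, PFilter.principal a = F := by
  refine ⟨fun h => ?_, fun ⟨a, ha⟩ => ha ▸ isCompactElement_principal a⟩
  obtain ⟨a, -, ha⟩ := mem_of_isCompactElement_of_isLUB h (F.nonempty.image _)
    (directedOn_principal_image F) (isLUB_principal_image F)
  exact ⟨a, ha⟩

theorem isCompactlyGenerated_pfilter : IsCompactlyGenerated (PFilter M) :=
  ⟨fun F => ⟨_, Set.forall_mem_image.2 fun a _ => isCompactElement_principal a,
    (isLUB_principal_image F).sSup_eq⟩⟩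

theorem isCompactElement_top_pfilter {b : M} (hb : ∀ a, b ≤ a) :
    IsCompactElement (⊤ : PFilter M) :=
  isCompactElement_pfilter_iff.2 ⟨b, top_le_iff.1 fun a _ => hb a⟩

/-- The preimage of a filter under a homomorphism. -/
def filterComap (α : InfTopHom M N) (G : PFilter N) : PFilter M :=
  (IsPFilter.of_def (F := {a : M | α a ∈ G}) ⟨⊤, by
      rw [Set.mem_ofPred_eq, map_top]
      exact PFilter.top_mem⟩
    (fun a ha b hb => ⟨a ⊓ b, by
      rw [Set.mem_ofPred_eq, map_inf]
      exact PFilter.inf_mem ha hb, inf_le_left, inf_le_right⟩)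
    (fun hab ha => PFilter.mem_of_le (OrderHomClass.mono α hab) ha)).toPFilter

theorem gc_filterMap (α : InfTopHom M N) : GaloisConnection (filterMap α) (filterComap α) :=
  fun _ _ => ⟨fun h a ha => h ⟨a, ha, le_rfl⟩,
    fun h _ ⟨_, ha, hab⟩ => PFilter.mem_of_le hab (h ha)⟩

theorem filterMap_principal (α : InfTopHom M N) (a : M) :
    filterMap α (PFilter.principal a) = PFilter.principal (α a) :=
  le_antisymm (fun _ ⟨_, ha', hb⟩ => (OrderHomClass.mono α ha').trans hb)
    (PFilter.principal_le_iff.2 ⟨a, le_rfl, le_rfl⟩)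

/-- A meet-semilattice is dual to the compact elements of its lattice of filters. -/
noncomputable def principalIso (M : Type u) [SemilatticeInf M] [OrderTop M] :
    M ≃o CompactsDual (PFilter M) :=
  RelIso.ofSurjective
    (OrderEmbedding.ofMapLEIff (fun a : M => (OrderDual.toDual
        ⟨PFilter.principal a, isCompactElement_principal a⟩ : CompactsDual (PFilter M)))
      fun _ _ => PFilter.principal_le_principal_iff)
    fun k => (isCompactElement_pfilter_iff.1 k.2).imp fun _ => Subtype.ext

end FilterLattice

theorem filterWellDefined : FilterWellDefined.{u} where
  algebraic _ := isCompactlyGenerated_pfilter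
  isKAlgFrm M := ⟨isFrameLattice_pfilter M.2.1,
    M.2.2.elim fun _ hb => isCompactElement_top_pfilter hb⟩
  map_sSup α S := by rw [(gc_filterMap (BDMS.toHom α)).l_sSup, sSup_image]
  map_compact α F hF := by
    obtain ⟨a, rfl⟩ := isCompactElement_pfilter_iff.1 hF
    rw [filterMap_principal]
    exact isCompactElement_principal _

/-! ### The semilattice of compact elements -/

section CompactSemilattice

variable {L : Type u} [CompleteLattice L]

theorem isDistributive_compactsDual [IsCompactlyGenerated L] (hL : IsFrameLattice L) :
    IsDistributiveMeetSemilattice (CompactsDual L) := by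
  intro a b c hc
  have hc : c.1 ≤ a.1 ⊔ b.1 := hc
  have hsplit : c.1 ≤ c.1 ⊓ a.1 ⊔ c.1 ⊓ b.1 := by rw [← hL.inf_sup_left, inf_eq_left.2 hc]
  obtain ⟨k, hk, hka, hck⟩ := exists_compact_le_map (scottContinuous_sup_right _) c.2 hsplit
  obtain ⟨l, hl, hlb, hcl⟩ :=
    exists_compact_le_map (scottContinuous_sup_right _) c.2 (hck.trans_eq (sup_comm ..))
  exact ⟨OrderDual.toDual ⟨k, hk⟩, OrderDual.toDual ⟨l, hl⟩, hka.trans inf_le_right,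
    hlb.trans inf_le_right, Subtype.ext <| le_antisymm
      (sup_le (hka.trans inf_le_left) (hlb.trans inf_le_left)) (hcl.trans_eq (sup_comm ..))⟩

/-- The filter of compact elements below `x`. -/
def compactFilter (x : L) : PFilter (CompactsDual L) :=
  (IsPFilter.of_def (F := {k : CompactsDual L | k.1 ≤ x}) ⟨⊤, (bot_le : (⊥ : L) ≤ x)⟩
    (fun _ hk _ hl => ⟨_, sup_le hk hl, inf_le_left, inf_le_right⟩)
    (fun {k l} (hkl : l.1 ≤ k.1) (hk : k.1 ≤ x) => hkl.trans hk)).toPFilter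

theorem compactFilter_le_compactFilter_iff [IsCompactlyGenerated L] {x y : L} :
    compactFilter x ≤ compactFilter y ↔ x ≤ y :=
  ⟨fun h => le_iff_compact_le_imp.2 fun k hk hkx =>
    h (show OrderDual.toDual ⟨k, hk⟩ ∈ compactFilter x from hkx), fun h _ hk => le_trans hk h⟩

theorem compactFilter_sSup (G : PFilter (CompactsDual L)) :
    compactFilter (sSup ((fun k : CompactsDual L => k.1) '' (G : Set (CompactsDual L)))) = G := by
  have hd : DirectedOn (· ≤ ·) ((fun k : CompactsDual L => k.1) '' (G : Set (CompactsDual L))) := by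
    rintro _ ⟨a, ha, rfl⟩ _ ⟨b, hb, rfl⟩
    exact ⟨_, ⟨a ⊓ b, PFilter.inf_mem ha hb, rfl⟩, (inf_le_left : a ⊓ b ≤ a),
      (inf_le_right : a ⊓ b ≤ b)⟩
  refine SetLike.ext fun k => ⟨fun hk => ?_, fun hk => le_sSup ⟨k, hk, rfl⟩⟩
  obtain ⟨_, ⟨l, hl, rfl⟩, hkl⟩ := k.2 _ _ (G.nonempty.image _) hd (isLUB_sSup _) hk
  exact PFilter.mem_of_le (show l ≤ k from hkl) hl

/-- An algebraic lattice is the lattice of filters of the dual of its compact elements. -/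
noncomputable def compactFilterIso (L : Type u) [CompleteLattice L] [IsCompactlyGenerated L] :
    L ≃o PFilter (CompactsDual L) :=
  RelIso.ofSurjective
    (OrderEmbedding.ofMapLEIff compactFilter fun _ _ => compactFilter_le_compactFilter_iff)
    fun G => ⟨_, compactFilter_sSup G⟩

end CompactSemilattice

theorem compactWellDefined : CompactWellDefined.{u} := fun L =>
  ⟨isDistributive_compactsDual L.2.1, OrderDual.toDual ⟨⊤, L.2.2⟩, fun a => (le_top : a.1 ≤ ⊤)⟩

/-- The unit `M ≅ K(Filt(M))`, `a ↦ ↑a`. -/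
noncomputable def filterUnitIso :
    𝟭 BDMS.{u} ≅ filterFunctor filterWellDefined ⋙ compactFunctor compactWellDefined :=
  NatIso.ofComponents (fun M => BDMS.isoMk (principalIso M.obj)) fun {M N} α => by
    apply InducedCategory.hom_ext
    apply InfTopHom.ext
    intro a
    apply Subtype.ext
    exact (filterMap_principal (BDMS.toHom α) a).symm

/-- The inverse of the counit, `L ≅ Filt(K(L))`. -/
noncomputable def filterCounitIso :
    𝟭 KAlgFrmJ.{u} ≅ compactFunctor compactWellDefined ⋙ filterFunctor filterWellDefined :=
  NatIso.ofComponents (fun L => KAlgFrmJ.isoMk (compactFilterIso L.obj.carrier)) fun {L M} α => by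
    apply InducedCategory.hom_ext
    apply AlgLatHom.ext
    funext x
    apply SetLike.ext (A := PFilter (CompactsDual M.obj))
    intro k
    have hα := (KAlgFrmJ.toHom α).scottContinuous
    change k.1 ≤ (KAlgFrmJ.toHom α).toFun x ↔
      ∃ l : CompactsDual L.obj, l.1 ≤ x ∧ k.1 ≤ (KAlgFrmJ.toHom α).toFun l.1
    refine ⟨fun h => ?_, fun ⟨l, hl, hk⟩ => hk.trans (hα.monotone hl)⟩
    obtain ⟨l, hl, hlx, hkl⟩ := exists_compact_le_map hα k.2 h
    exact ⟨OrderDual.toDual ⟨l, hl⟩, hlx, hkl⟩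

/-- The equivalence of bounded distributive meet-semilattices and compact algebraic frames. -/
noncomputable def filterEquivalence : BDMS.{u} ≌ KAlgFrmJ.{u} :=
  CategoryTheory.Equivalence.mk (filterFunctor filterWellDefined)
    (compactFunctor compactWellDefined) filterUnitIso filterCounitIso.symm

/-! ### Compact Priestley spaces -/

section Priestley

variable {X : Type*} [PartialOrder X] [TopologicalSpace X] [PriestleySpace X]

theorem isClosed_Ici_of_priestley (x : X) : IsClosed (Set.Ici x) := by
  rw [← isOpen_compl_iff, isOpen_iff_mem_nhds]
  intro y hy
  obtain ⟨U, hU, hup, hxU, hyU⟩ := exists_isClopen_upper_of_not_le hy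
  exact Filter.mem_of_superset (hU.compl.isOpen.mem_nhds hyU) fun z hz hxz => hz (hup hxz hxU)

theorem exists_le_maximal_of_isClosed [CompactSpace X] {C : Set X} (hC : IsClosed C) {x : X}
    (hx : x ∈ C) : ∃ m, x ≤ m ∧ Maximal (· ∈ C) m := by
  refine zorn_le_nonempty₀ C (fun c hcC hc y hy => ?_) x hx
  have : Nonempty c := ⟨⟨y, hy⟩⟩
  have hcl : ∀ a : c, IsClosed (Set.Ici a.1 ∩ C) := fun a =>
    (isClosed_Ici_of_priestley a.1).inter hC
  have hdir : Directed (· ⊇ ·) fun a : c => Set.Ici a.1 ∩ C := fun a b => by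
    rcases hc.total a.2 b.2 with h | h
    · exact ⟨b, Set.inter_subset_inter_left _ (Set.Ici_subset_Ici.2 h), subset_rfl⟩
    · exact ⟨a, subset_rfl, Set.inter_subset_inter_left _ (Set.Ici_subset_Ici.2 h)⟩
  obtain ⟨z, hz⟩ := IsCompact.nonempty_iInter_of_directed_nonempty_isCompact_isClosed _ hdir
    (fun a => ⟨a.1, le_rfl, hcC a.2⟩) (fun a => (hcl a).isCompact) hcl
  rw [Set.mem_iInter] at hz
  exact ⟨z, (hz ⟨y, hy⟩).2, fun a ha => (hz ⟨a, ha⟩).1⟩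

end Priestley

/-! ### Prime and pseudoprime elements -/

section PrimeElements

variable {L : Type u} [CompleteLattice L]

theorem exists_infPrime_of_not_le (hL : IsFrameLattice L) {k b : L} (hk : IsCompactElement k)
    (hkb : ¬ k ≤ b) : ∃ p, InfPrime p ∧ b ≤ p ∧ ¬ k ≤ p := by
  let _ := hL.toFrame
  obtain ⟨m, hbm, hm⟩ := zorn_le_nonempty₀ {x : L | ¬ k ≤ x} (fun c hc hch y hy =>
    ⟨sSup c, fun hle => by
      obtain ⟨x, hx, hkx⟩ := hk c _ ⟨y, hy⟩ hch.directedOn (isLUB_sSup c) hle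
      exact hc hx hkx, fun _ => le_sSup⟩) b hkb
  have le_of_lt : ∀ {x}, m < x → k ≤ x := fun hx => by
    by_contra hn
    exact hx.not_ge (hm.2 hn hx.le)
  have hirr : InfIrred m := by
    refine ⟨fun hmax => hm.1 (le_top.trans_eq hmax.eq_top.symm), fun x y hxy => ?_⟩
    by_contra! hne
    exact hm.1 ((le_inf (le_of_lt ((hxy.symm.trans_le inf_le_left).lt_of_ne' hne.1))
      (le_of_lt ((hxy.symm.trans_le inf_le_right).lt_of_ne' hne.2))).trans_eq hxy)
  exact ⟨m, hirr.infPrime, hbm, hm.1⟩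

variable [IsCompactlyGenerated L]

theorem infPrime_iff_directedOn {p : L} (hp : p ≠ ⊤) :
    InfPrime p ↔ DirectedOn (· ≥ ·) {k | IsCompactElement k ∧ ¬ k ≤ p} := by
  constructor
  · rintro ⟨-, h⟩ k ⟨-, hkp⟩ l ⟨-, hlp⟩
    obtain ⟨m, hm, hmkl, hmp⟩ :=
      exists_compact_of_not_le fun hkl : k ⊓ l ≤ p => (h hkl).elim hkp hlp
    exact ⟨m, ⟨hm, hmp⟩, hmkl.trans inf_le_left, hmkl.trans inf_le_right⟩
  · refine fun hd => ⟨fun h => hp h.eq_top, fun a b hab => ?_⟩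
    by_contra! hn
    obtain ⟨k, hk, hka, hkp⟩ := exists_compact_of_not_le hn.1
    obtain ⟨l, hl, hlb, hlp⟩ := exists_compact_of_not_le hn.2
    obtain ⟨m, ⟨-, hmp⟩, hmk, hml⟩ := hd k ⟨hk, hkp⟩ l ⟨hl, hlp⟩
    exact hmp ((le_inf (le_trans hmk hka) (le_trans hml hlb)).trans hab)

theorem wayBelow_iff {a b : L} : WayBelow a b ↔ ∃ k, IsCompactElement k ∧ a ≤ k ∧ k ≤ b := by
  constructor
  · intro h
    obtain ⟨T, hT, haT⟩ := h _ (sSup_compact_le_eq b).ge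
    rw [← Finset.sup_id_eq_sSup] at haT
    exact ⟨T.sup id, CompleteLattice.isCompactElement_finsetSup T fun x hx => (hT hx).1, haT,
      Finset.sup_le fun x hx => (hT hx).2⟩
  · rintro ⟨k, hk, hak, hkb⟩ S hS
    obtain ⟨T, hT, hkT⟩ :=
      (CompleteLattice.isCompactElement_iff_exists_le_sSup_of_le_sSup L k).1 hk S
        (hkb.trans hS)
    rw [Finset.sup_id_eq_sSup] at hkT
    exact ⟨T, hT, hak.trans hkT⟩

theorem isPseudoprime_iff {p : L} :
    IsPseudoprime p ↔ p ≠ ⊤ ∧ ∀ (s : Finset L) (k : L), (∀ a ∈ s, IsCompactElement a) →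
      IsCompactElement k → k ≤ p → s.inf id ≤ k → ∃ a ∈ s, a ≤ p := by
  classical
  refine and_congr_right fun _ => ⟨fun h s k _ hk hkp hsk => h s (wayBelow_iff.2 ⟨k, hk, hsk, hkp⟩),
    fun h s hs => ?_⟩
  obtain ⟨k, hk, hsk, hkp⟩ := wayBelow_iff.1 hs
  by_contra! hn
  choose! f hf hfa hfp using fun a ha => exists_compact_of_not_le (hn a ha)
  have hinf : (s.image f).inf id ≤ s.inf id := by
    rw [Finset.inf_image]
    exact Finset.inf_mono_fun hfa
  obtain ⟨b, hb, hbp⟩ := h (s.image f) k (Finset.forall_mem_image.2 hf) hk hkp (hinf.trans hsk)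
  obtain ⟨a, ha, rfl⟩ := Finset.mem_image.1 hb
  exact hfp a ha hbp

theorem isPseudoprime_of_infPrime {p : L} (hp : InfPrime p) : IsPseudoprime p :=
  isPseudoprime_iff.2 ⟨hp.ne_top, fun _ _ _ _ hkp hsk => hp.finset_inf_le.1 (hsk.trans hkp)⟩

theorem exists_prime_pp_of_not_le (hL : IsFrameLattice L) {a b : L} (h : ¬ a ≤ b) :
    ∃ p : PP L, p ∈ PP.primes L ∧ b ≤ p.1 ∧ ¬ a ≤ p.1 := by
  obtain ⟨k, hk, hka, hkb⟩ := exists_compact_of_not_le h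
  obtain ⟨p, hp, hbp, hkp⟩ := exists_infPrime_of_not_le hL hk hkb
  exact ⟨⟨p, isPseudoprime_of_infPrime hp⟩, hp, hbp, fun h => hkp (hka.trans h)⟩

end PrimeElements

/-! ### The topology on the set of pseudoprime elements -/

section PseudoprimeTopology

variable {L : Type u} [CompleteLattice L]

/-- The trace `↑a ∩ PP(L)` of a principal upset on the pseudoprime elements; for compact `a` these
are the clopen sets that generate the topology. -/
def PP.above (a : L) : Set (PP L) := {p | a ≤ p.1}

theorem PP.above_anti {a b : L} (h : a ≤ b) : PP.above b ⊆ PP.above a := fun _ hp => h.trans hp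

theorem PP.above_sup (a b : L) : PP.above (a ⊔ b) = PP.above a ∩ PP.above b :=
  Set.ext fun _ => sup_le_iff

theorem PP.above_bot : PP.above (⊥ : L) = Set.univ := Set.eq_univ_of_forall fun _ => bot_le

theorem PP.isUpperSet_above (a : L) : IsUpperSet (PP.above a) := fun _ _ hpq hp => le_trans hp hpq

theorem PP.above_subset_above_iff [IsCompactlyGenerated L] (hL : IsFrameLattice L) {a b : L} :
    PP.above a ⊆ PP.above b ↔ b ≤ a := by
  refine ⟨fun h => ?_, PP.above_anti⟩
  by_contra hn
  obtain ⟨q, -, haq, hbq⟩ := exists_prime_pp_of_not_le hL hn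
  exact hbq (h haq)

theorem PP.topology_eq_generateFrom :
    instTopologicalSpacePP L = TopologicalSpace.generateFrom
      ({U | ∃ k, IsCompactElement k ∧ U = PP.above k} ∪
        {U | ∃ k, IsCompactElement k ∧ U = (PP.above k)ᶜ}) := by
  refine induced_generateFrom_eq.trans (congrArg _ ?_)
  ext U
  constructor
  · rintro ⟨_, ⟨k, hk, rfl⟩ | ⟨k, hk, rfl⟩, rfl⟩
    exacts [Or.inl ⟨k, hk, rfl⟩, Or.inr ⟨k, hk, rfl⟩]
  · rintro (⟨k, hk, rfl⟩ | ⟨k, hk, rfl⟩)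
    exacts [⟨_, Or.inl ⟨k, hk, rfl⟩, rfl⟩, ⟨_, Or.inr ⟨k, hk, rfl⟩, rfl⟩]

theorem PP.isClopen_above {k : L} (hk : IsCompactElement k) : IsClopen (PP.above k) := by
  rw [IsClopen, ← isOpen_compl_iff, PP.topology_eq_generateFrom]
  exact ⟨TopologicalSpace.isOpen_generateFrom_of_mem (Or.inr ⟨k, hk, rfl⟩),
    TopologicalSpace.isOpen_generateFrom_of_mem (Or.inl ⟨k, hk, rfl⟩)⟩

theorem PP.exists_above_diff_subset {O : Set (PP L)} (hO : IsOpen O) {p : PP L} (hp : p ∈ O) :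
    ∃ (k : L) (s : Finset L), IsCompactElement k ∧ (∀ l ∈ s, IsCompactElement l) ∧
      p ∈ PP.above k \ ⋃ l ∈ s, PP.above l ∧ PP.above k \ ⋃ l ∈ s, PP.above l ⊆ O := by
  classical
  rw [PP.topology_eq_generateFrom] at hO
  change TopologicalSpace.GenerateOpen _ O at hO
  induction hO with
  | basic U hU =>
    rcases hU with ⟨k, hk, rfl⟩ | ⟨k, hk, rfl⟩
    · exact ⟨k, ∅, hk, by simp, ⟨hp, by simp⟩, Set.sdiff_subset⟩
    · exact ⟨⊥, {k}, isCompactElement_bot', by simpa using hk, ⟨bot_le, by simpa using hp⟩,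
        fun q hq => by simpa using hq.2⟩
  | univ => exact ⟨⊥, ∅, isCompactElement_bot', by simp, ⟨bot_le, by simp⟩, Set.subset_univ _⟩
  | inter U V _ _ ihU ihV =>
    obtain ⟨k, s, hk, hs, hpU, hU⟩ := ihU hp.1
    obtain ⟨l, t, hl, ht, hpV, hV⟩ := ihV hp.2
    have hinter : PP.above (k ⊔ l) \ ⋃ x ∈ s ∪ t, PP.above x =
        (PP.above k \ ⋃ x ∈ s, PP.above x) ∩ (PP.above l \ ⋃ x ∈ t, PP.above x) := by
      rw [PP.above_sup, Finset.set_biUnion_union]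
      simp only [Set.sdiff_eq, Set.compl_union, Set.inter_inter_inter_comm]
    refine ⟨k ⊔ l, s ∪ t, isCompactElement_sup' hk hl, fun x hx => ?_, ?_, ?_⟩
    · exact (Finset.mem_union.1 hx).elim (hs x) (ht x)
    · exact hinter ▸ ⟨hpU, hpV⟩
    · exact hinter ▸ Set.inter_subset_inter hU hV
  | sUnion S _ ih =>
    obtain ⟨U, hU, hpU⟩ := hp
    obtain ⟨k, s, hk, hs, hp, h⟩ := ih U hU hpU
    exact ⟨k, s, hk, hs, hp, h.trans (Set.subset_sUnion_of_mem hU)⟩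

/-- The limit of an ultrafilter on the pseudoprime elements, as an element of the lattice. -/
def PP.ultrafilterLim (𝒰 : Ultrafilter (PP L)) : L :=
  sSup {k | IsCompactElement k ∧ PP.above k ∈ 𝒰}

theorem PP.le_ultrafilterLim_iff (𝒰 : Ultrafilter (PP L)) {k : L} (hk : IsCompactElement k) :
    k ≤ PP.ultrafilterLim 𝒰 ↔ PP.above k ∈ 𝒰 := by
  refine ⟨fun h => ?_, fun h => le_sSup ⟨hk, h⟩⟩
  obtain ⟨l, hl, hkl⟩ := hk {k | IsCompactElement k ∧ PP.above k ∈ 𝒰} _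
    ⟨⊥, isCompactElement_bot', Filter.mem_of_superset Filter.univ_mem PP.above_bot.ge⟩
    (fun k hk l hl => ⟨k ⊔ l, ⟨isCompactElement_sup' hk.1 hl.1, by
      rw [PP.above_sup]
      exact Filter.inter_mem hk.2 hl.2⟩, le_sup_left, le_sup_right⟩) (isLUB_sSup _) h
  exact Filter.mem_of_superset hl.2 (PP.above_anti hkl)

variable [IsCompactlyGenerated L]

theorem PP.above_subset_biUnion_above {s : Finset L} {k : L} (hs : ∀ a ∈ s, IsCompactElement a)
    (hk : IsCompactElement k) (h : s.inf id ≤ k) : PP.above k ⊆ ⋃ a ∈ s, PP.above a := fun p hp =>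
  let ⟨a, ha, hap⟩ := (isPseudoprime_iff.1 p.2).2 s k hs hk hp h
  Set.mem_iUnion₂.2 ⟨a, ha, hap⟩

theorem isPseudoprime_ultrafilterLim (htop : IsCompactElement (⊤ : L)) (𝒰 : Ultrafilter (PP L)) :
    IsPseudoprime (PP.ultrafilterLim 𝒰) := by
  refine isPseudoprime_iff.2 ⟨fun h => ?_, fun s k hs hk hk𝒰 hsk => ?_⟩
  · obtain ⟨q, hq⟩ := 𝒰.nonempty_of_mem ((PP.le_ultrafilterLim_iff 𝒰 htop).1 h.ge)
    exact q.2.1 (top_le_iff.1 hq)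
  · have hmem := Filter.mem_of_superset ((PP.le_ultrafilterLim_iff 𝒰 hk).1 hk𝒰)
      (PP.above_subset_biUnion_above hs hk hsk)
    obtain ⟨a, ha, ha𝒰⟩ := (Ultrafilter.finite_biUnion_mem_iff s.finite_toSet).1 hmem
    exact ⟨a, ha, (PP.le_ultrafilterLim_iff 𝒰 (hs a ha)).2 ha𝒰⟩

theorem compactSpace_pp (htop : IsCompactElement (⊤ : L)) : CompactSpace (PP L) := by
  refine ⟨isCompact_iff_ultrafilter_le_nhds.2 fun 𝒰 _ =>
    ⟨⟨_, isPseudoprime_ultrafilterLim htop 𝒰⟩, Set.mem_univ _, ?_⟩⟩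
  rw [PP.topology_eq_generateFrom, TopologicalSpace.nhds_generateFrom]
  refine le_iInf₂ ?_
  rintro _ ⟨hmem, ⟨k, hk, rfl⟩ | ⟨k, hk, rfl⟩⟩
  · exact Filter.le_principal_iff.2 ((PP.le_ultrafilterLim_iff 𝒰 hk).1 hmem)
  · exact Filter.le_principal_iff.2 (Ultrafilter.compl_mem_iff_notMem.2
      fun h => hmem ((PP.le_ultrafilterLim_iff 𝒰 hk).2 h))

theorem priestleySpace_pp : PriestleySpace (PP L) := ⟨fun h => by
  obtain ⟨k, hk, hkp, hkq⟩ := exists_compact_of_not_le h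
  exact ⟨_, PP.isClopen_above hk, PP.isUpperSet_above k, hkp, hkq⟩⟩

theorem dense_pp_primes (hL : IsFrameLattice L) : Dense (PP.primes L) := by
  intro p
  rw [mem_closure_iff]
  intro O hO hpO
  obtain ⟨k, s, hk, hs, hp, hkO⟩ := PP.exists_above_diff_subset hO hpO
  have hsk : ¬ s.inf id ≤ k := fun hsk => hp.2 (PP.above_subset_biUnion_above hs hk hsk hp.1)
  obtain ⟨q, hq, hkq, hsq⟩ := exists_prime_pp_of_not_le hL hsk
  refine ⟨q, hkO ⟨hkq, fun h => ?_⟩, hq⟩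
  obtain ⟨l, hl, hlq⟩ := Set.mem_iUnion₂.1 h
  exact hsq ((Finset.inf_le hl).trans hlq)

end PseudoprimeTopology

/-! ### The generalized Priestley space of pseudoprime elements -/

section PseudoprimeSpace

variable {L : Type u} [CompleteLattice L] [IsCompactlyGenerated L]

theorem exists_compact_above_subset (htop : IsCompactElement (⊤ : L)) {U : Set (PP L)}
    (hU : IsOpen U) {a : L} (h : PP.above a ⊆ U) :
    ∃ k, IsCompactElement k ∧ k ≤ a ∧ PP.above k ⊆ U := by
  have := compactSpace_pp htop
  have : Nonempty {k : L // IsCompactElement k ∧ k ≤ a} := (compact_le_nonempty a).to_subtype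
  obtain ⟨k, hk⟩ := exists_subset_nhds_of_compactSpace
    (V := fun k : {k : L // IsCompactElement k ∧ k ≤ a} => PP.above k.1)
    (fun k l => ⟨⟨k.1 ⊔ l.1, isCompactElement_sup' k.2.1 l.2.1, sup_le k.2.2 l.2.2⟩,
      PP.above_anti le_sup_left, PP.above_anti le_sup_right⟩)
    (fun k => (PP.isClopen_above k.2.1).isClosed) fun p hp => hU.mem_nhds <| h <|
      le_iff_compact_le_imp.2 fun k hk hka => Set.mem_iInter.1 hp ⟨k, hk, hka⟩
  exact ⟨k.1, k.2.1, k.2.2, hk⟩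

theorem isAdmissible_above (hL : IsFrameLattice L) {k : L} (hk : IsCompactElement k) :
    IsAdmissible (PP.primes L) (PP.above k) := by
  refine ⟨PP.isClopen_above hk, PP.isUpperSet_above k, fun p hp => ?_⟩
  obtain ⟨q, hq, hpq, hkq⟩ := exists_prime_pp_of_not_le hL hp.1
  rwa [le_antisymm (show p ≤ q from hpq) (hp.2 hkq hpq)]

theorem above_finset_inf_subset (htop : IsCompactElement (⊤ : L)) {U : Set (PP L)}
    (hU : IsAdmissible (PP.primes L) U) {ι : Type*} {t : Finset ι} {f : ι → L}
    (h : ∀ i ∈ t, PP.above (f i) ⊆ U) : PP.above (t.inf f) ⊆ U := by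
  have := compactSpace_pp htop
  have := priestleySpace_pp (L := L)
  intro p hp
  by_contra hpU
  obtain ⟨m, hpm, hm⟩ := exists_le_maximal_of_isClosed hU.1.compl.isClosed hpU
  obtain ⟨i, hi, him⟩ := (InfPrime.finset_inf_le (hU.2.2 hm)).1 (hp.trans hpm)
  exact hm.1 (h i hi him)

theorem exists_compact_above_eq (htop : IsCompactElement (⊤ : L)) {U : Set (PP L)}
    (hU : IsAdmissible (PP.primes L) U) : ∃ k, IsCompactElement k ∧ PP.above k = U := by
  have := compactSpace_pp htop
  have hcompact : ∀ x : U, ∃ k, IsCompactElement k ∧ k ≤ x.1.1 ∧ PP.above k ⊆ U := fun x =>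
    exists_compact_above_subset htop hU.1.isOpen fun p hp => hU.2.1 hp x.2
  choose f hf hfx hfU using hcompact
  obtain ⟨t, ht⟩ := hU.1.isClosed.isCompact.elim_nhds_subcover' (fun x hx => PP.above (f ⟨x, hx⟩))
    fun x hx => (PP.isClopen_above (hf _)).isOpen.mem_nhds (hfx ⟨x, hx⟩)
  obtain ⟨k, hk, hkt, hkU⟩ := exists_compact_above_subset htop hU.1.isOpen
    (above_finset_inf_subset htop hU fun x (_ : x ∈ t) => hfU x)
  refine ⟨k, hk, hkU.antisymm fun p hp => ?_⟩
  obtain ⟨x, hx, hxp⟩ := Set.mem_iUnion₂.1 (ht hp)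
  exact (hkt.trans (Finset.inf_le hx)).trans hxp

theorem isAdmissible_pp_iff (hL : IsFrameLattice L) (htop : IsCompactElement (⊤ : L))
    {U : Set (PP L)} :
    IsAdmissible (PP.primes L) U ↔ ∃ k, IsCompactElement k ∧ PP.above k = U :=
  ⟨exists_compact_above_eq htop, fun ⟨_, hk, hU⟩ => hU ▸ isAdmissible_above hL hk⟩

theorem isGPS_pp (hL : IsFrameLattice L) (htop : IsCompactElement (⊤ : L)) :
    IsGPS (PP L) (PP.primes L) where
  compact := compactSpace_pp htop
  priestley := priestleySpace_pp
  dense := dense_pp_primes hL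
  order_dense p := by
    obtain ⟨q, hq, hpq, -⟩ := exists_prime_pp_of_not_le hL fun h => p.2.1 (top_le_iff.1 h)
    exact ⟨q, hq, hpq⟩
  mem_iff p := by
    have himage : {U | IsAdmissible (PP.primes L) U ∧ p ∉ U} =
        PP.above '' {k | IsCompactElement k ∧ ¬ k ≤ p.1} := by
      ext U
      rw [Set.mem_ofPred_eq, isAdmissible_pp_iff hL htop]
      constructor
      · rintro ⟨⟨k, hk, rfl⟩, hp⟩
        exact ⟨k, ⟨hk, hp⟩, rfl⟩
      · rintro ⟨k, ⟨hk, hp⟩, rfl⟩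
        exact ⟨⟨k, hk, rfl⟩, hp⟩
    have hpreimage : (PP.above (L := L) ⁻¹'o (· ⊆ ·)) = (· ≥ ·) := by
      funext k l
      exact propext (PP.above_subset_above_iff hL)
    rw [himage, directedOn_image, hpreimage]
    exact infPrime_iff_directedOn p.2.1
  le_iff p q := ⟨fun h U hU hp => hU.2.1 h hp, fun h => le_iff_compact_le_imp.2 fun _ hk =>
    h _ (isAdmissible_above hL hk)⟩

variable {M : Type u} [CompleteLattice M]

theorem box_ppRel (hL : IsFrameLattice L) (α : AlgLatHom L M) (k : L) :
    box (ppRel α) (PP.above k) = PP.above (α.toFun k) := by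
  ext p
  refine ⟨fun h => (gc_rightAdj α k p.1).2 ?_, fun h q hq => ((gc_rightAdj α k p.1).1 h).trans hq⟩
  by_contra hn
  obtain ⟨q, -, hrq, hkq⟩ := exists_prime_pp_of_not_le hL hn
  exact hkq (h q hrq)

theorem isGPMorphism_ppRel [IsCompactlyGenerated M] (hL : IsFrameLattice L)
    (htop : IsCompactElement (⊤ : L)) (hM : IsFrameLattice M) (α : AlgLatHom L M) :
    IsGPMorphism (PP.primes M) (PP.primes L) (ppRel α) where
  exists_of_not_rel p q h := by
    obtain ⟨k, hk, hkp, hkq⟩ := exists_compact_of_not_le h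
    exact ⟨_, isAdmissible_above hL hk, fun _ => hkp.trans, hkq⟩
  box_admissible U hU := by
    obtain ⟨k, hk, rfl⟩ := (isAdmissible_pp_iff hL htop).1 hU
    rw [box_ppRel hL]
    exact isAdmissible_above hM (α.map_compact k hk)

end PseudoprimeSpace

/-! ### Generalized Priestley morphisms and their action on admissible upsets -/

section Morphisms

variable {X Y : Type u} [PartialOrder X] [TopologicalSpace X] [PartialOrder Y]
  [TopologicalSpace Y] {X₀ : Set X} {Y₀ : Set Y}

theorem IsGPMorphism.rel_iff {R : X → Y → Prop} (hR : IsGPMorphism X₀ Y₀ R) {x : X} {y : Y} :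
    R x y ↔ ∀ U, IsAdmissible Y₀ U → x ∈ box R U → y ∈ U := by
  refine ⟨fun h U _ hx => hx y h, fun h => ?_⟩
  by_contra hn
  obtain ⟨U, hU, hx, hy⟩ := hR.exists_of_not_rel x y hn
  exact hy (h U hU hx)

theorem IsGPMorphism.eq_relComp {W : Type u} {T : X → Y → Prop} (hT : IsGPMorphism X₀ Y₀ T)
    {R : X → W → Prop} {S : W → Y → Prop}
    (h : ∀ U, IsAdmissible Y₀ U → box T U = box R (box S U)) : T = relComp Y₀ R S := by
  funext x y
  exact propext <| hT.rel_iff.trans <| forall₂_congr fun U hU => by rw [h U hU]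

theorem GPSHom.ext_box {X Y : GPS.{u}} {R S : GPSHom X Y}
    (h : ∀ U, IsAdmissible Y.X₀ U → box R.rel U = box S.rel U) : R = S := by
  apply GPSHom.ext
  funext x y
  exact propext <| R.isGPMorphism.rel_iff.trans <|
    (forall₂_congr fun U hU => by rw [h U hU]).trans S.isGPMorphism.rel_iff.symm

end Morphisms

theorem ppWellDefined : PPWellDefined.{u} where
  isGPS L := isGPS_pp L.2.1 L.2.2
  isGPMorphism {L M} α := isGPMorphism_ppRel L.2.1 L.2.2 M.2.1 _
  map_comp {L M N} α β := by
    refine (isGPMorphism_ppRel L.2.1 L.2.2 N.2.1 _).eq_relComp fun U hU => ?_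
    obtain ⟨k, -, rfl⟩ := (isAdmissible_pp_iff L.2.1 L.2.2).1 hU
    rw [box_ppRel L.2.1, box_ppRel L.2.1, box_ppRel M.2.1]
    rfl

/-! ### Admissible clopen and closed upsets -/

section AdmissibleUpsets

variable {X : Type u} [PartialOrder X] [TopologicalSpace X] {X₀ : Set X}

theorem IsAdmissibleClosed.exists_le_notMem {C : Set X} (hC : IsAdmissibleClosed X₀ C) {x : X}
    (hx : x ∉ C) : ∃ y ∈ X₀, x ≤ y ∧ y ∉ C := by
  obtain ⟨y, hy, hxy⟩ : x ∈ {x | ∃ y ∈ X₀ \ C, x ≤ y} := hC.2.2 ▸ hx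
  exact ⟨y, hy.1, hxy, hy.2⟩

theorem IsAdmissibleClosed.subset_iff {C D : Set X} (hC : IsAdmissibleClosed X₀ C)
    (hD : IsUpperSet D) : D ⊆ C ↔ ∀ y ∈ X₀, y ∈ D → y ∈ C := by
  refine ⟨fun h y _ hy => h hy, fun h x hx => ?_⟩
  by_contra hn
  obtain ⟨y, hy, hxy, hyC⟩ := hC.exists_le_notMem hn
  exact hyC (h y hy (hD hxy hx))

section

variable [CompactSpace X] [PriestleySpace X]

theorem IsAdmissible.exists_le_notMem {U : Set X} (hU : IsAdmissible X₀ U) {x : X} (hx : x ∉ U) :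
    ∃ y ∈ X₀, x ≤ y ∧ y ∉ U := by
  obtain ⟨m, hxm, hm⟩ := exists_le_maximal_of_isClosed hU.1.compl.isClosed hx
  exact ⟨m, hU.2.2 hm, hxm, hm.1⟩

theorem isAdmissibleClosed_sInter {S : Set (Set X)} (hS : ∀ U ∈ S, IsAdmissible X₀ U) :
    IsAdmissibleClosed X₀ (⋂₀ S) := by
  have hup : IsUpperSet (⋂₀ S) := isUpperSet_sInter fun U hU => (hS U hU).2.1
  refine ⟨isClosed_sInter fun U hU => (hS U hU).1.isClosed, hup, Set.Subset.antisymm ?_ ?_⟩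
  · intro x hx
    rw [Set.mem_compl_iff, Set.mem_sInter] at hx
    push Not at hx
    obtain ⟨U, hU, hxU⟩ := hx
    obtain ⟨y, hy, hxy, hyU⟩ := (hS U hU).exists_le_notMem hxU
    exact ⟨y, ⟨hy, fun hn => hyU (hn U hU)⟩, hxy⟩
  · rintro x ⟨y, hy, hxy⟩ hx
    exact hy.2 (hup hxy hx)

theorem IsAdmissible.isAdmissibleClosed {U : Set X} (hU : IsAdmissible X₀ U) :
    IsAdmissibleClosed X₀ U := by
  rw [← Set.sInter_singleton U]
  exact isAdmissibleClosed_sInter fun V hV => Set.mem_singleton_iff.1 hV ▸ hU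

end

theorem IsGPS.isAdmissible_empty (h : IsGPS X X₀) : IsAdmissible X₀ (∅ : Set X) :=
  ⟨isClopen_empty, isUpperSet_empty, fun x hx => by
    obtain ⟨y, hy, hxy⟩ := h.order_dense x
    rwa [le_antisymm hxy (hx.2 (Set.notMem_empty y) hxy)]⟩

theorem IsGPS.exists_isAdmissible_superset (h : IsGPS X X₀) {C : Set X} (hC : IsClosed C)
    (hup : IsUpperSet C) {y : X} (hy : y ∈ X₀) (hyC : y ∉ C) :
    ∃ U, IsAdmissible X₀ U ∧ C ⊆ U ∧ y ∉ U := by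
  have := h.compact
  have : Nonempty {U // IsAdmissible X₀ U ∧ y ∉ U} :=
    ⟨⟨∅, h.isAdmissible_empty, Set.notMem_empty y⟩⟩
  have hcover : C ⊆ ⋃ U : {U // IsAdmissible X₀ U ∧ y ∉ U}, U.1 := fun c hc => by
    have hcy : ¬ c ≤ y := fun hcy => hyC (hup hcy hc)
    rw [h.le_iff] at hcy
    push Not at hcy
    obtain ⟨U, hU, hcU, hyU⟩ := hcy
    exact Set.mem_iUnion.2 ⟨⟨U, hU, hyU⟩, hcU⟩
  have hdir : Directed (· ⊆ ·) fun U : {U // IsAdmissible X₀ U ∧ y ∉ U} => U.1 :=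
    directedOn_iff_directed.1 ((h.mem_iff y).1 hy)
  obtain ⟨U, hU⟩ := hC.isCompact.elim_directed_cover _ (fun U => U.2.1.1.isOpen) hcover hdir
  exact ⟨U.1, U.2.1, hU, U.2.2⟩

theorem IsAdmissibleClosed.eq_sInter (h : IsGPS X X₀) {C : Set X} (hC : IsAdmissibleClosed X₀ C) :
    C = ⋂₀ {U | IsAdmissible X₀ U ∧ C ⊆ U} := by
  refine (Set.subset_sInter fun U hU => hU.2).antisymm fun x hx => ?_
  by_contra hn
  obtain ⟨y, hy, hxy, hyC⟩ := hC.exists_le_notMem hn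
  obtain ⟨U, hU, hCU, hyU⟩ := h.exists_isAdmissible_superset hC.1 hC.2.1 hy hyC
  exact hyU (hU.2.1 hxy (hx U ⟨hU, hCU⟩))

end AdmissibleUpsets

/-! ### The frame of admissible closed upsets -/

section ClosedAdmLattice

instance (X : GPS.{u}) : CompactSpace X := X.isGPS.compact

instance (X : GPS.{u}) : PriestleySpace X := X.isGPS.priestley

variable {X Y : GPS.{u}}

/-- An admissible clopen upset as an admissible closed upset. -/
def Adm.toClosedAdm (U : Adm X) : ClosedAdm X := ⟨U.1, U.2.isAdmissibleClosed⟩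

theorem ClosedAdm.le_iff {C D : ClosedAdm X} : C ≤ D ↔ ∀ y ∈ X.X₀, y ∈ D.val → y ∈ C.val :=
  C.property.subset_iff D.property.2.1

theorem ClosedAdm.mem_sSup {S : Set (ClosedAdm X)} {x : X} :
    x ∈ (sSup S).val ↔ ∀ C ∈ S, x ∈ C.val := Set.mem_iInter₂

theorem ClosedAdm.mem_inf {C D : ClosedAdm X} {y : X} (hy : y ∈ X.X₀) :
    y ∈ (C ⊓ D).val ↔ y ∈ C.val ∨ y ∈ D.val := by
  refine ⟨fun h => ?_, fun h => h.elim (fun h => (inf_le_left : C ⊓ D ≤ C) h)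
    fun h => (inf_le_right : C ⊓ D ≤ D) h⟩
  by_contra hn
  obtain ⟨U, hU, hCU, hyU⟩ := X.isGPS.exists_isAdmissible_superset
    (C.property.1.union D.property.1) (C.property.2.1.union D.property.2.1) hy hn
  have hle : Adm.toClosedAdm ⟨U, hU⟩ ≤ C ⊓ D :=
    le_inf (Set.subset_union_left.trans hCU) (Set.subset_union_right.trans hCU)
  exact hyU (hle h)

theorem isFrameLattice_closedAdm : IsFrameLattice (ClosedAdm X) := by
  intro C S
  apply le_antisymm
  · refine ClosedAdm.le_iff.2 fun y hy h => (ClosedAdm.mem_inf hy).2 ?_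
    by_contra! hn
    refine hn.2 (ClosedAdm.mem_sSup.2 fun D hD => ?_)
    exact ((ClosedAdm.mem_inf hy).1 (ClosedAdm.mem_sSup.1 h _ ⟨D, hD, rfl⟩)).resolve_left hn.1
  · exact sSup_le <| Set.forall_mem_image.2 fun D hD => inf_le_inf_left _ (le_sSup hD)

theorem isCompactElement_toClosedAdm (U : Adm X) : IsCompactElement (Adm.toClosedAdm U) := by
  rw [CompleteLattice.isCompactElement_iff_le_of_directed_sSup_le]
  intro S hS hd hle
  have : Nonempty S := hS.to_subtype
  obtain ⟨D, hD⟩ := exists_subset_nhds_of_compactSpace (V := fun D : S => D.1.val) (U := U.1)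
    (directedOn_iff_directed.1 hd) (fun D => D.1.property.1)
    (fun x hx => U.2.1.isOpen.mem_nhds
      (hle (ClosedAdm.mem_sSup.2 fun C hC => Set.mem_iInter.1 hx ⟨C, hC⟩)))
  exact ⟨D.1, D.2, hD⟩

theorem sSup_toClosedAdm (C : ClosedAdm X) :
    sSup (Adm.toClosedAdm '' {U | U.toClosedAdm ≤ C}) = C := by
  refine le_antisymm (sSup_le (Set.forall_mem_image.2 fun _ hU => hU)) fun x hx => ?_
  rw [C.property.eq_sInter X.isGPS]
  exact fun U hU => ClosedAdm.mem_sSup.1 hx _ ⟨⟨U, hU.1⟩, hU.2, rfl⟩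

theorem directedOn_toClosedAdm (C : ClosedAdm X) :
    DirectedOn (· ≤ ·) (Adm.toClosedAdm '' {U | U.toClosedAdm ≤ C}) := by
  rintro _ ⟨U, hU, rfl⟩ _ ⟨V, hV, rfl⟩
  exact ⟨_, ⟨U ⊓ V, Set.subset_inter hU hV, rfl⟩, Set.inter_subset_left, Set.inter_subset_right⟩

theorem isCompactElement_closedAdm_iff {C : ClosedAdm X} :
    IsCompactElement C ↔ IsAdmissible X.X₀ C.val := by
  refine ⟨fun h => ?_, fun h => isCompactElement_toClosedAdm ⟨C.val, h⟩⟩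
  have hne : (Adm.toClosedAdm '' {U | U.toClosedAdm ≤ C}).Nonempty :=
    ⟨_, ⊤, Set.subset_univ C.val, rfl⟩
  obtain ⟨U, -, rfl⟩ := mem_of_isCompactElement_of_isLUB h hne (directedOn_toClosedAdm C)
    (isLUB_iff_sSup_eq.2 (sSup_toClosedAdm C))
  exact U.2

instance isCompactlyGenerated_closedAdm : IsCompactlyGenerated (ClosedAdm X) :=
  ⟨fun C => ⟨_, Set.forall_mem_image.2 fun U _ => isCompactElement_toClosedAdm U,
    sSup_toClosedAdm C⟩⟩

theorem isCompactElement_top_closedAdm : IsCompactElement (⊤ : ClosedAdm X) := by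
  have htop : (⊤ : ClosedAdm X).val = ∅ := Set.subset_empty_iff.1
    (le_top : Adm.toClosedAdm ⟨∅, X.isGPS.isAdmissible_empty⟩ ≤ (⊤ : ClosedAdm X))
  rw [isCompactElement_closedAdm_iff, htop]
  exact X.isGPS.isAdmissible_empty

theorem box_sInter {X Y : Type u} (R : X → Y → Prop) (S : Set (Set Y)) :
    box R (⋂₀ S) = ⋂₀ (box R '' S) := by
  ext x
  rw [Set.sInter_image, Set.mem_iInter₂]
  exact ⟨fun h U hU y hy => h y hy U hU, fun h y hy U hU => h U hU y hy⟩

theorem isAdmissibleClosed_box (R : GPSHom X Y) (C : ClosedAdm Y) :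
    IsAdmissibleClosed X.X₀ (box R.rel C.val) := by
  rw [C.property.eq_sInter Y.isGPS, box_sInter]
  exact isAdmissibleClosed_sInter <| Set.forall_mem_image.2 fun U hU =>
    R.isGPMorphism.box_admissible U hU.1

end ClosedAdmLattice

theorem vietorisWellDefined : VietorisWellDefined.{u} where
  algebraic _ := isCompactlyGenerated_closedAdm
  isKAlgFrm _ := ⟨isFrameLattice_closedAdm, isCompactElement_top_closedAdm⟩
  box_mem R C := isAdmissibleClosed_box R C
  map_sSup R S := by
    apply ClosedAdm.ext
    ext x
    rw [ClosedAdm.mem_sSup, Set.forall_mem_image]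
    exact ⟨fun h C hC y hy => ClosedAdm.mem_sSup.1 (h y hy) C hC,
      fun h y hy => ClosedAdm.mem_sSup.2 fun C hC => h hC y hy⟩
  map_compact R C hC := isCompactElement_closedAdm_iff.2
    (R.isGPMorphism.box_admissible _ (isCompactElement_closedAdm_iff.1 hC))
  map_comp {X Y Z} R S C := by
    rw [C.property.eq_sInter Z.isGPS, box_sInter, box_sInter, box_sInter, Set.image_image]
    exact congrArg Set.sInter (Set.image_congr fun U hU => box_relComp _ _ _ hU.1)

/-! ### The semilattice of admissible clopen upsets -/

theorem IsDistributiveMeetSemilattice.of_orderIso {M N : Type u} [SemilatticeInf M]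
    [SemilatticeInf N] (e : M ≃o N) (h : IsDistributiveMeetSemilattice M) :
    IsDistributiveMeetSemilattice N := by
  intro a b c habc
  obtain ⟨a', b', ha, hb, hab⟩ := h (e.symm a) (e.symm b) (e.symm c)
    ((e.symm.map_inf a b).symm.trans_le (e.symm.monotone habc))
  refine ⟨e a', e b', e.symm_apply_le.1 ha, e.symm_apply_le.1 hb, ?_⟩
  rw [← e.map_inf, hab, e.apply_symm_apply]

/-- The admissible clopen upsets are dual to the compact admissible closed upsets. -/
def admIso (X : GPS.{u}) : Adm X ≃o CompactsDual (ClosedAdm X) where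
  toFun U := OrderDual.toDual ⟨Adm.toClosedAdm U, isCompactElement_toClosedAdm U⟩
  invFun C := ⟨C.1.val, isCompactElement_closedAdm_iff.1 C.2⟩
  left_inv _ := rfl
  right_inv _ := rfl
  map_rel_iff' := Iff.rfl

theorem admWellDefined : AdmWellDefined.{u} := fun X =>
  ⟨(isDistributive_compactsDual isFrameLattice_closedAdm).of_orderIso (admIso X).symm,
    ⟨∅, X.isGPS.isAdmissible_empty⟩, fun U => Set.empty_subset U.1⟩

/-- `𝒜 ≅ 𝒦 ∘ 𝒱ᵃ`, given by the identity maps. -/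
def admVietorisIso : admFunctor admWellDefined.{u} ≅
    vietorisFunctor vietorisWellDefined ⋙ compactFunctor compactWellDefined :=
  NatIso.ofComponents (fun X => BDMS.isoMk (admIso X.unop)) fun _ => rfl

section FullyFaithful

variable {X Y : GPS.{u}}

/-- The morphism of spaces induced by a homomorphism of the semilattices of admissible clopen
upsets. -/
def admRel (f : InfTopHom (Adm Y) (Adm X)) (x : X) (y : Y) : Prop :=
  ∀ U : Adm Y, x ∈ (f U).1 → y ∈ U.1

theorem box_admRel (f : InfTopHom (Adm Y) (Adm X)) (U : Adm Y) :
    box (admRel f) U.1 = (f U).1 := by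
  ext x
  refine ⟨fun h => ?_, fun h y hy => hy U h⟩
  have : Nonempty {V : Adm Y // x ∈ (f V).1} := ⟨⊤, by
    rw [map_top]
    exact Set.mem_univ x⟩
  have hdir : Directed (· ⊇ ·) fun V : {V : Adm Y // x ∈ (f V).1} => V.1.1 := fun V W =>
    ⟨⟨V.1 ⊓ W.1, by
      rw [map_inf]
      exact ⟨V.2, W.2⟩⟩, Set.inter_subset_left, Set.inter_subset_right⟩
  obtain ⟨V, hV⟩ := exists_subset_nhds_of_compactSpace hdir (fun V => V.1.2.1.isClosed)
    fun y hy => U.2.1.isOpen.mem_nhds (h y fun V hV => Set.mem_iInter.1 hy ⟨V, hV⟩)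
  exact OrderHomClass.mono f (show V.1 ≤ U from hV) V.2

theorem isGPMorphism_admRel (f : InfTopHom (Adm Y) (Adm X)) :
    IsGPMorphism X.X₀ Y.X₀ (admRel f) where
  exists_of_not_rel x y h := by
    obtain ⟨U, hU⟩ := not_forall.1 h
    obtain ⟨hx, hy⟩ := Classical.not_imp.1 hU
    exact ⟨U.1, U.2, fun z hz => hz U hx, hy⟩
  box_admissible U hU := by
    rw [box_admRel f ⟨U, hU⟩]
    exact (f ⟨U, hU⟩).2

end FullyFaithful

/-- `𝒜` is fully faithful: `f` is recovered from the relation `admRel f`. -/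
def fullyFaithfulAdmFunctor : (admFunctor admWellDefined.{u}).FullyFaithful where
  preimage {X Y} f := Quiver.Hom.op (V := GPS.{u}) (X := Y.unop) (Y := X.unop)
    ⟨admRel (BDMS.toHom f), isGPMorphism_admRel _⟩
  map_preimage f := by
    apply InducedCategory.hom_ext
    apply InfTopHom.ext
    exact fun U => Subtype.ext (box_admRel (BDMS.toHom f) U)
  preimage_map {X Y} R := by
    apply Quiver.Hom.unop_inj
    exact GPSHom.ext_box fun U hU => box_admRel (X := Y.unop) (Y := X.unop) _ ⟨U, hU⟩

/-! ### Isomorphisms of spaces with a distinguished subset -/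

theorem box_preimage {X Y X' Y' : Type u} {R : X → Y → Prop} {d : X' → X} {e : Y' → Y}
    (he : Function.Surjective e) (U : Set Y) :
    box (fun x y => R (d x) (e y)) (e ⁻¹' U) = d ⁻¹' box R U :=
  Set.ext fun x => (he.forall (p := fun y => R (d x) y → y ∈ U)).symm

section SpaceIso

variable {X Y X' Y' : Type u} [PartialOrder X] [TopologicalSpace X] [PartialOrder Y]
  [TopologicalSpace Y] [PartialOrder X'] [TopologicalSpace X'] [PartialOrder Y']
  [TopologicalSpace Y'] {X₀ : Set X} {Y₀ : Set Y} {X₀' : Set X'} {Y₀' : Set Y'}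

/-- Isomorphisms of ordered topological spaces with distinguished subsets: order isomorphisms that
are homeomorphisms and match the distinguished subsets. Since an order isomorphism is bijective,
inducing the topology is enough. -/
structure IsSpaceIso (X₀ : Set X) (Y₀ : Set Y) (e : X ≃o Y) : Prop where
  isInducing : Topology.IsInducing e
  preimage_eq : e ⁻¹' Y₀ = X₀

theorem IsSpaceIso.refl (X₀ : Set X) : IsSpaceIso X₀ X₀ (OrderIso.refl X) :=
  ⟨Topology.IsInducing.id, rfl⟩

variable {d : X' ≃o X} {e : Y' ≃o Y}

theorem IsSpaceIso.isHomeomorph (he : IsSpaceIso Y₀' Y₀ e) : IsHomeomorph e :=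
  (e.toEquiv.toHomeomorphOfIsInducing he.isInducing).isHomeomorph

theorem IsSpaceIso.isAdmissible_preimage_iff (he : IsSpaceIso Y₀' Y₀ e) {U : Set Y} :
    IsAdmissible Y₀' (e ⁻¹' U) ↔ IsAdmissible Y₀ U := by
  have hupper : IsUpperSet (e ⁻¹' U) ↔ IsUpperSet U := by
    refine ⟨fun h => ?_, fun h => h.preimage e.monotone⟩
    simpa only [e.symm_preimage_preimage] using h.preimage e.symm.monotone
  have hmaximal : {y | Maximal (· ∈ (e ⁻¹' U)ᶜ) y} = e ⁻¹' {y | Maximal (· ∈ Uᶜ) y} := by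
    ext y
    simp only [Set.mem_ofPred_eq, Set.mem_preimage, Maximal, e.surjective.forall, e.le_iff_le,
      Set.mem_compl_iff]
  rw [IsAdmissible, IsAdmissible, he.isHomeomorph.isQuotientMap.isClopen_preimage, hupper, hmaximal,
    ← he.preimage_eq, e.surjective.preimage_subset_preimage_iff]

theorem IsSpaceIso.isGPS (he : IsSpaceIso Y₀' Y₀ e) (hY : IsGPS Y Y₀) : IsGPS Y' Y₀' where
  compact :=
    have := hY.compact
    he.isHomeomorph.isClosedEmbedding.compactSpace
  priestley := ⟨fun h => by
    have := hY.priestley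
    obtain ⟨U, hU, hup, hx, hy⟩ := exists_isClopen_upper_of_not_le (mt e.le_iff_le.1 h)
    exact ⟨e ⁻¹' U, hU.preimage he.isHomeomorph.continuous, hup.preimage e.monotone, hx, hy⟩⟩
  dense := he.preimage_eq ▸ hY.dense.preimage he.isHomeomorph.isOpenMap
  order_dense := by
    rw [← he.preimage_eq]
    exact fun x => e.surjective.exists.1 (hY.order_dense (e x)) |>.imp fun _ => And.imp_right
      e.le_iff_le.1
  mem_iff x := by
    have himage : {U | IsAdmissible Y₀' U ∧ x ∉ U} =
        (e ⁻¹' ·) '' {U | IsAdmissible Y₀ U ∧ e x ∉ U} := by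
      ext U
      obtain ⟨V, rfl⟩ := e.injective.preimage_surjective U
      rw [(e.surjective.preimage_injective).mem_set_image, Set.mem_ofPred_eq,
        he.isAdmissible_preimage_iff]
      rfl
    have hpreimage : ((e ⁻¹' · : Set Y → Set Y') ⁻¹'o (· ⊆ ·)) = (· ⊆ ·) := by
      funext U V
      exact propext e.surjective.preimage_subset_preimage_iff
    rw [himage, directedOn_image, hpreimage, ← hY.mem_iff, ← he.preimage_eq, Set.mem_preimage]
  le_iff x y := by
    rw [← e.le_iff_le, hY.le_iff, e.injective.preimage_surjective.forall]
    simp only [he.isAdmissible_preimage_iff, Set.mem_preimage]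

theorem IsGPMorphism.comp_spaceIso (hd : IsSpaceIso X₀' X₀ d) (he : IsSpaceIso Y₀' Y₀ e)
    {R : X → Y → Prop} (hR : IsGPMorphism X₀ Y₀ R) :
    IsGPMorphism X₀' Y₀' fun x y => R (d x) (e y) where
  exists_of_not_rel x y h := by
    obtain ⟨U, hU, hx, hy⟩ := hR.exists_of_not_rel _ _ h
    exact ⟨e ⁻¹' U, he.isAdmissible_preimage_iff.2 hU, fun z hz => hx _ hz, hy⟩
  box_admissible U hU := by
    obtain ⟨V, rfl⟩ := e.injective.preimage_surjective U
    rw [box_preimage e.surjective, hd.isAdmissible_preimage_iff]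
    exact hR.box_admissible V (he.isAdmissible_preimage_iff.1 hU)

theorem relComp_comp_spaceIso {V W V' W' : Type u} (he : IsSpaceIso Y₀' Y₀ e) (R : V → W → Prop)
    (S : W → Y → Prop) (g : V' → V) {h : W' → W} (hh : Function.Surjective h) :
    relComp Y₀' (fun v w => R (g v) (h w)) (fun w y => S (h w) (e y)) =
      fun v y => relComp Y₀ R S (g v) (e y) := by
  funext v y
  simp only [relComp, e.injective.preimage_surjective.forall, he.isAdmissible_preimage_iff,
    box_preimage e.surjective, box_preimage hh, Set.mem_preimage]

theorem IsGPMorphism.le_relComp {R : X → Y → Prop} (hR : IsGPMorphism X₀ Y₀ R) :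
    relComp Y₀ (· ≤ ·) R = R :=
  (hR.eq_relComp fun U hU => (box_le (hR.box_admissible U hU).2.1).symm).symm

theorem IsGPMorphism.relComp_le {R : X → Y → Prop} (hR : IsGPMorphism X₀ Y₀ R) :
    relComp Y₀ R (· ≤ ·) = R :=
  (hR.eq_relComp fun U hU => by rw [box_le hU.2.1]).symm

end SpaceIso

/-- The categorical isomorphism given by an isomorphism of spaces; its relations are `e x ≤ y` and
`y ≤ e x`. -/
def GPS.isoMk {X Y : GPS.{u}} (e : X ≃o Y) (he : IsSpaceIso X.X₀ Y.X₀ e) : X ≅ Y where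
  hom := ⟨fun x y => e x ≤ y,
    (GPS.toHom (𝟙 Y)).isGPMorphism.comp_spaceIso he (IsSpaceIso.refl Y.X₀)⟩
  inv := ⟨fun y x => y ≤ e x,
    (GPS.toHom (𝟙 Y)).isGPMorphism.comp_spaceIso (IsSpaceIso.refl Y.X₀) he⟩
  hom_inv_id := by
    apply GPSHom.ext
    refine (relComp_comp_spaceIso he (· ≤ ·) (· ≤ ·) e Function.surjective_id).trans ?_
    funext x y
    exact (congrFun₂ (GPS.toHom (𝟙 Y)).isGPMorphism.le_relComp (e x) (e y)).trans
      (propext e.le_iff_le)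
  inv_hom_id := by
    apply GPSHom.ext
    exact (relComp_comp_spaceIso (IsSpaceIso.refl Y.X₀) (· ≤ ·) (· ≤ ·) id e.surjective).trans
      (GPS.toHom (𝟙 Y)).isGPMorphism.le_relComp

/-! ### The distributive envelope -/

open scoped FinsetFamily in
theorem finset_sup_infs {M D F : Type*} [SemilatticeInf M] [DecidableEq M] [DistribLattice D]
    [OrderBot D] [FunLike F M D] [InfHomClass F M D] (f : F) (s t : Finset M) :
    (s ⊼ t).sup f = s.sup f ⊓ t.sup f := by
  refine (Finset.sup_image₂_left ..).trans ?_
  rw [Finset.sup_inf_distrib_right]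
  simp only [map_inf, Finset.sup_inf_distrib_left]

section Envelope

variable {M : Type u} [SemilatticeInf M]

theorem exists_inf_le_of_forall_inf_le (hM : IsDistributiveMeetSemilattice M) {a c : M}
    (s : Finset M) (h : ∀ b ∈ s, a ⊓ b ≤ c) : ∃ d ∈ upperBounds (s : Set M), c ≤ d ∧ a ⊓ d ≤ c := by
  classical
  induction s using Finset.induction_on with
  | empty => exact ⟨c, by simp, le_rfl, inf_le_right⟩
  | insert b s _ ih =>
    obtain ⟨d, hsd, hcd, had⟩ := ih fun x hx => h x (Finset.mem_insert_of_mem hx)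
    obtain ⟨a', d', ha', hbd', rfl⟩ := hM a b d ((h b (Finset.mem_insert_self b s)).trans hcd)
    refine ⟨d', ?_, hcd.trans inf_le_right, ?_⟩
    · rw [Finset.coe_insert, upperBounds_insert]
      exact ⟨hbd', upperBounds_mono_mem inf_le_right hsd⟩
    · exact (le_inf inf_le_left (inf_le_inf_right d' ha')).trans had

theorem isLUB_image_inf (hM : IsDistributiveMeetSemilattice M) {a : M} {s : Finset M}
    (h : a ∈ lowerBounds (upperBounds (s : Set M))) : IsLUB ((a ⊓ ·) '' (s : Set M)) a := by
  refine ⟨Set.forall_mem_image.2 fun b _ => inf_le_left, fun c hc => ?_⟩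
  obtain ⟨d, hsd, -, had⟩ := exists_inf_le_of_forall_inf_le hM s (Set.forall_mem_image.1 hc)
  exact (le_inf le_rfl (h hsd)).trans had

variable [OrderTop M]

/-- The join of `s` need not exist, but `a` is the join of the elements `a ⊓ b` with `b ∈ s`, and
that one is preserved. -/
theorem PreservesExistingFiniteJoins.le_sup (hM : IsDistributiveMeetSemilattice M) {E : Type u}
    [DistribLattice E] [BoundedOrder E] {f : InfTopHom M E} (hf : PreservesExistingFiniteJoins f)
    {a : M} {s : Finset M} (h : a ∈ lowerBounds (upperBounds (s : Set M))) : f a ≤ s.sup f := by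
  classical
  have hlub := isLUB_image_inf hM h
  rw [← Finset.coe_image] at hlub
  refine (hf _ a hlub).2 ?_
  rw [Finset.coe_image, Set.image_image]
  exact Set.forall_mem_image.2 fun b hb =>
    (OrderHomClass.mono f inf_le_right).trans (Finset.le_sup hb)

variable (M) in
/-- The representation of `M` by sets of prime elements of `Filt(M)`, which sends `a` to the set of
primes that contain `a`. -/
def primeSet : InfTopHom M (Set {P : PFilter M // InfPrime P}) where
  toFun a := {P | a ∈ P.1}
  map_inf' _ _ := Set.ext fun _ => PFilter.inf_mem_iff
  map_top' := Set.eq_univ_of_forall fun _ => PFilter.top_mem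

theorem mem_sup_primeSet {s : Finset M} {P : {P : PFilter M // InfPrime P}} :
    P ∈ s.sup (primeSet M) ↔ ∃ b ∈ s, b ∈ P.1 := by
  rw [Finset.sup_set_eq_biUnion, Set.mem_iUnion₂]
  simp only [exists_prop]
  rfl

theorem finset_inf_principal_le_iff {s : Finset M} {a : M} :
    s.inf PFilter.principal ≤ PFilter.principal a ↔
      a ∈ lowerBounds (upperBounds (s : Set M)) := by
  have hmem : ∀ c, c ∈ s.inf PFilter.principal ↔ c ∈ upperBounds (s : Set M) := fun c => by
    rw [← PFilter.principal_le_iff, Finset.le_inf_iff]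
    exact forall₂_congr fun b _ => PFilter.principal_le_principal_iff
  exact forall_congr' fun c => imp_congr (hmem c) PFilter.mem_principal

theorem primeSet_le_sup_iff (hM : IsDistributiveMeetSemilattice M) {a : M} {s : Finset M} :
    primeSet M a ≤ s.sup (primeSet M) ↔ a ∈ lowerBounds (upperBounds (s : Set M)) := by
  rw [← finset_inf_principal_le_iff]
  constructor
  · intro h
    by_contra hn
    have := isCompactlyGenerated_pfilter (M := M)
    obtain ⟨P, hP, haP, hsP⟩ := exists_prime_pp_of_not_le (isFrameLattice_pfilter hM) hn
    obtain ⟨b, hb, hbP⟩ := mem_sup_primeSet.1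
      (@h ⟨P.1, hP⟩ (PFilter.principal_le_iff.1 haP))
    exact hsP ((Finset.inf_le hb).trans (PFilter.principal_le_iff.2 hbP))
  · intro h P hP
    obtain ⟨b, hb, hbP⟩ := P.2.finset_inf_le.1 (h.trans (PFilter.principal_le_iff.2 hP))
    exact mem_sup_primeSet.2 ⟨b, hb, PFilter.principal_le_iff.1 hbP⟩

variable (M) in
/-- The distributive envelope of `M`, realized as the lattice of finite unions of sets
`primeSet M a`. -/
def envelope : Sublattice (Set {P : PFilter M // InfPrime P}) where
  carrier := Set.range fun s : Finset M => s.sup (primeSet M)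
  supClosed' := by
    classical
    rintro _ ⟨s, rfl⟩ _ ⟨t, rfl⟩
    exact ⟨s ∪ t, Finset.sup_union⟩
  infClosed' := by
    classical
    rintro _ ⟨s, rfl⟩ _ ⟨t, rfl⟩
    exact ⟨_, finset_sup_infs _ s t⟩

instance : BoundedOrder (envelope M) where
  top := ⟨⊤, {⊤}, Finset.sup_singleton.trans (map_top _)⟩
  le_top _ := Set.subset_univ _
  bot := ⟨⊥, ∅, Finset.sup_empty⟩
  bot_le _ := Set.empty_subset _

variable (M) in
/-- The canonical map from a meet-semilattice to its distributive envelope. -/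
def toEnvelope : InfTopHom M (envelope M) where
  toFun a := ⟨primeSet M a, {a}, Finset.sup_singleton⟩
  map_inf' a b := Subtype.ext (map_inf (primeSet M) a b)
  map_top' := Subtype.ext (map_top (primeSet M))

theorem coe_sup_toEnvelope (s : Finset M) :
    ((s.sup (toEnvelope M) : envelope M) : Set _) = s.sup (primeSet M) :=
  Finset.apply_sup_eq_sup_comp Subtype.val (fun _ _ => rfl) rfl

theorem toEnvelope_le_sup_iff (hM : IsDistributiveMeetSemilattice M) {a : M} {s : Finset M} :
    toEnvelope M a ≤ s.sup (toEnvelope M) ↔ a ∈ lowerBounds (upperBounds (s : Set M)) := by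
  rw [← primeSet_le_sup_iff hM, ← coe_sup_toEnvelope]
  rfl

theorem exists_sup_toEnvelope_eq (V : envelope M) : ∃ s : Finset M, s.sup (toEnvelope M) = V :=
  let ⟨s, hs⟩ := V.2
  ⟨s, Subtype.ext ((coe_sup_toEnvelope s).trans hs)⟩

theorem preserves_toEnvelope (hM : IsDistributiveMeetSemilattice M) :
    PreservesExistingFiniteJoins (toEnvelope M) := fun _ _ ha =>
  ⟨Set.forall_mem_image.2 fun _ hb => OrderHomClass.mono (toEnvelope M) (ha.1 hb), fun _ hV =>
    ((toEnvelope_le_sup_iff hM).2 ha.2).trans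
      (Finset.sup_le fun _ hb => hV (Set.mem_image_of_mem _ hb))⟩

section Lift

variable {E : Type u} [DistribLattice E] [BoundedOrder E] {f : InfTopHom M E}

theorem sup_le_sup_of_toEnvelope_le (hM : IsDistributiveMeetSemilattice M)
    (hf : PreservesExistingFiniteJoins f) {s t : Finset M}
    (h : s.sup (toEnvelope M) ≤ t.sup (toEnvelope M)) : s.sup f ≤ t.sup f :=
  Finset.sup_le fun _ ha =>
    hf.le_sup hM ((toEnvelope_le_sup_iff hM).1 ((Finset.le_sup ha).trans h))

theorem exists_map_sup_toEnvelope (hM : IsDistributiveMeetSemilattice M)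
    (hf : PreservesExistingFiniteJoins f) :
    ∃ g : envelope M → E, ∀ s : Finset M, g (s.sup (toEnvelope M)) = s.sup f := by
  choose r hr using exists_sup_toEnvelope_eq (M := M)
  exact ⟨fun V => (r V).sup f, fun s => le_antisymm
    (sup_le_sup_of_toEnvelope_le hM hf (hr _).le) (sup_le_sup_of_toEnvelope_le hM hf (hr _).ge)⟩

theorem exists_envelope_lift (hM : IsDistributiveMeetSemilattice M)
    (hf : PreservesExistingFiniteJoins f) :
    ∃ g : BoundedLatticeHom (envelope M) E, ∀ a, g (toEnvelope M a) = f a := by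
  classical
  obtain ⟨g, hg⟩ := exists_map_sup_toEnvelope hM hf
  have hga : ∀ a, g (toEnvelope M a) = f a := fun a => by
    have := hg {a}
    rwa [Finset.sup_singleton, Finset.sup_singleton] at this
  refine ⟨{ toFun := g, map_sup' := ?_, map_inf' := ?_, map_top' := ?_, map_bot' := hg ∅ }, hga⟩
  · intro V W
    obtain ⟨s, rfl⟩ := exists_sup_toEnvelope_eq V
    obtain ⟨t, rfl⟩ := exists_sup_toEnvelope_eq W
    rw [← Finset.sup_union, hg, hg, hg, Finset.sup_union]
  · intro V W
    obtain ⟨s, rfl⟩ := exists_sup_toEnvelope_eq V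
    obtain ⟨t, rfl⟩ := exists_sup_toEnvelope_eq W
    rw [← finset_sup_infs, hg, hg, hg, finset_sup_infs]
  · have := hga ⊤
    rwa [map_top, map_top] at this

end Lift

theorem isDistributiveEnvelope_toEnvelope (hM : IsDistributiveMeetSemilattice M) :
    IsDistributiveEnvelope (toEnvelope M) where
  preserves := preserves_toEnvelope hM
  existsUnique E _ _ f hf := by
    obtain ⟨g, hg⟩ := exists_envelope_lift hM hf
    refine ⟨g, hg, fun g' hg' => ?_⟩
    apply BoundedLatticeHom.ext
    intro V
    obtain ⟨s, rfl⟩ := exists_sup_toEnvelope_eq V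
    rw [map_finset_sup, map_finset_sup]
    exact Finset.sup_congr rfl fun a _ => (hg' a).trans (hg a).symm

end Envelope

/-! ### Optimal filters -/

section OptimalFilters

variable {M : Type u} [SemilatticeInf M] [OrderTop M]

/-- The ideal of the distributive envelope generated by the elements of `M` outside `F`. -/
def envelopeIdeal (F : PFilter M) : Ideal (envelope M) where
  carrier := {V | ∃ s : Finset M, (∀ b ∈ s, b ∉ F) ∧ V ≤ s.sup (toEnvelope M)}
  lower' := fun _ _ hWV ⟨s, hs, hV⟩ => ⟨s, hs, hWV.trans hV⟩
  nonempty' := ⟨⊥, ∅, by simp, bot_le⟩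
  directed' := by
    classical
    rintro V ⟨s, hs, hV⟩ W ⟨t, ht, hW⟩
    refine ⟨V ⊔ W, ⟨s ∪ t, fun b hb => (Finset.mem_union.1 hb).elim (hs b) (ht b), ?_⟩,
      le_sup_left, le_sup_right⟩
    rw [Finset.sup_union]
    exact sup_le_sup hV hW

theorem toEnvelope_mem_envelopeIdeal {F : PFilter M} {a : M} (ha : a ∉ F) :
    toEnvelope M a ∈ envelopeIdeal F :=
  ⟨{a}, by simpa using ha,
    (Finset.sup_singleton (f := toEnvelope M) (b := a)).ge⟩

theorem IsOptimal.exists_mem (hM : IsDistributiveMeetSemilattice M) {F : PFilter M}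
    (hF : IsOptimal F) {s : Finset M} {a : M} (ha : a ∈ F)
    (hs : a ∈ lowerBounds (upperBounds (s : Set M))) : ∃ b ∈ s, b ∈ F := by
  obtain ⟨D, _, _, e, he, P, hP, hPF⟩ := hF
  by_contra! hn
  have hsup : s.sup e ∈ hP.compl_ideal.toIdeal :=
    (Ideal.finsetSup_mem_iff _).2 fun b hb hbP => hn b hb ((hPF b).2 hbP)
  exact hsup (PFilter.mem_of_le (he.preserves.le_sup hM hs) ((hPF a).1 ha))

theorem isOptimal_of_forall_exists_mem (hM : IsDistributiveMeetSemilattice M) {F : PFilter M}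
    (h : ∀ (s : Finset M) (a : M), a ∈ F → a ∈ lowerBounds (upperBounds (s : Set M)) →
      ∃ b ∈ s, b ∈ F) : IsOptimal F := by
  have hdisj : Disjoint (filterMap (toEnvelope M) F : Set (envelope M)) (envelopeIdeal F) := by
    rw [Set.disjoint_left]
    rintro V ⟨a, ha, haV⟩ ⟨s, hs, hVs⟩
    obtain ⟨b, hb, hbF⟩ := h s a ha ((toEnvelope_le_sup_iff hM).1 (haV.trans hVs))
    exact hs b hb hbF
  obtain ⟨J, hJ, hIJ, hFJ⟩ := DistribLattice.prime_ideal_of_disjoint_filter_ideal hdisj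
  refine ⟨_, _, _, toEnvelope M, isDistributiveEnvelope_toEnvelope hM, hJ.toPrimePair.F,
    hJ.toPrimePair.F_isPrime, fun a => ⟨fun ha => ?_, fun ha => ?_⟩⟩
  · exact Set.disjoint_left.1 hFJ ⟨a, ha, le_rfl⟩
  · by_contra hn
    exact ha (hIJ (toEnvelope_mem_envelopeIdeal hn))

theorem isOptimal_iff (hM : IsDistributiveMeetSemilattice M) {F : PFilter M} :
    IsOptimal F ↔ ∀ (s : Finset M) (a : M), a ∈ F →
      a ∈ lowerBounds (upperBounds (s : Set M)) → ∃ b ∈ s, b ∈ F :=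
  ⟨fun hF _ _ => hF.exists_mem hM, isOptimal_of_forall_exists_mem hM⟩

theorem isPseudoprime_pfilter_iff (hbot : ∃ b : M, ∀ a, b ≤ a) {F : PFilter M} :
    IsPseudoprime F ↔ ∀ (s : Finset M) (a : M), a ∈ F →
      a ∈ lowerBounds (upperBounds (s : Set M)) → ∃ b ∈ s, b ∈ F := by
  classical
  have := isCompactlyGenerated_pfilter (M := M)
  rw [isPseudoprime_iff]
  constructor
  · rintro ⟨-, h⟩ s a ha hs
    rw [← finset_inf_principal_le_iff] at hs
    obtain ⟨G, hG, hGF⟩ := h (s.image PFilter.principal) (PFilter.principal a)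
      (Finset.forall_mem_image.2 fun b _ => isCompactElement_principal b)
      (isCompactElement_principal a) (PFilter.principal_le_iff.2 ha)
      (by rwa [Finset.inf_image])
    obtain ⟨b, hb, rfl⟩ := Finset.mem_image.1 hG
    exact ⟨b, hb, PFilter.principal_le_iff.1 hGF⟩
  · refine fun h => ⟨?_, fun s k hs hk hkF hsk => ?_⟩
    · rintro rfl
      obtain ⟨b, hb⟩ := hbot
      obtain ⟨c, hc, -⟩ := h ∅ b (PFilter.principal_le_iff.1 le_top) fun c _ => hb c
      exact Finset.notMem_empty c hc
    · obtain ⟨a, rfl⟩ := isCompactElement_pfilter_iff.1 hk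
      obtain ⟨t, -, rfl⟩ := Finset.subset_set_image_iff.1 fun G hG =>
        Set.image_univ.ge (isCompactElement_pfilter_iff.1 (hs G hG))
      rw [Finset.inf_image, Function.id_comp, finset_inf_principal_le_iff] at hsk
      obtain ⟨b, hb, hbF⟩ := h t a (PFilter.principal_le_iff.1 hkF) hsk
      exact ⟨_, Finset.mem_image_of_mem _ hb, PFilter.principal_le_iff.2 hbF⟩

theorem isOptimal_iff_isPseudoprime (hM : IsDistributiveMeetSemilattice M)
    (hbot : ∃ b : M, ∀ a, b ≤ a) {F : PFilter M} : IsOptimal F ↔ IsPseudoprime F :=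
  (isOptimal_iff hM).trans (isPseudoprime_pfilter_iff hbot).symm

theorem isPrimeFilter_iff_infPrime {P : PFilter M} : IsPrimeFilter P ↔ InfPrime P := by
  refine and_congr (not_iff_not.1 ?_) (forall₂_congr fun F G => imp_congr_left ?_)
  · rw [not_not, isMax_iff_eq_top, not_exists_not, ← top_le_iff]
    exact ⟨fun h a _ => h a, fun h a => h (PFilter.principal_le_iff.1 le_top)⟩
  · exact forall_congr' fun a => imp_congr_left mem_pfilter_inf.symm

/-- The identity map from the optimal filters of `M` to the pseudoprime elements of `Filt(M)`. -/
def optOrderIso (hM : IsDistributiveMeetSemilattice M) (hbot : ∃ b : M, ∀ a, b ≤ a) :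
    Opt M ≃o PP (PFilter M) where
  toEquiv := Equiv.subtypeEquivRight fun _ => isOptimal_iff_isPseudoprime hM hbot
  map_rel_iff' := Iff.rfl

theorem isInducing_optOrderIso (hM : IsDistributiveMeetSemilattice M)
    (hbot : ∃ b : M, ∀ a, b ≤ a) : Topology.IsInducing (optOrderIso hM hbot) where
  eq_induced := by
    rw [PP.topology_eq_generateFrom, induced_generateFrom_eq]
    have hpreimage : ∀ a : M, optOrderIso hM hbot ⁻¹' PP.above (PFilter.principal a) =
        {F : Opt M | a ∈ F.1} := fun a => Set.ext fun F => PFilter.principal_le_iff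
    refine congrArg _ (Set.ext fun U => ⟨?_, ?_⟩)
    · rintro (⟨a, rfl⟩ | ⟨a, rfl⟩)
      · exact ⟨_, Or.inl ⟨_, isCompactElement_principal a, rfl⟩, hpreimage a⟩
      · exact ⟨_, Or.inr ⟨_, isCompactElement_principal a, rfl⟩, congrArg compl (hpreimage a)⟩
    · rintro ⟨_, ⟨k, hk, rfl⟩ | ⟨k, hk, rfl⟩, rfl⟩ <;>
        obtain ⟨a, rfl⟩ := isCompactElement_pfilter_iff.1 hk
      · exact Or.inl ⟨a, hpreimage a⟩
      · exact Or.inr ⟨a, congrArg compl (hpreimage a)⟩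

theorem isSpaceIso_optOrderIso (hM : IsDistributiveMeetSemilattice M)
    (hbot : ∃ b : M, ∀ a, b ≤ a) :
    IsSpaceIso (Opt.primes M) (PP.primes (PFilter M)) (optOrderIso hM hbot) where
  isInducing := isInducing_optOrderIso hM hbot
  preimage_eq := Set.ext fun _ => isPrimeFilter_iff_infPrime.symm

end OptimalFilters

section OptimalSpace

variable {M N : BDMS.{u}}

variable (M) in
/-- The isomorphism `optOrderIso` for an object of `BDMS`. -/
abbrev optIso : Opt M.obj ≃o PP (PFilter M.obj) := optOrderIso M.2.1 M.2.2

theorem isSpaceIso_optIso :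
    IsSpaceIso (Opt.primes M.obj) (PP.primes (PFilter M.obj)) (optIso M) :=
  isSpaceIso_optOrderIso M.2.1 M.2.2

theorem optRel_eq (α : M ⟶ N) : optRel (BDMS.toHom α) = fun x y =>
    ppRel (KAlgFrmJ.toHom ((filterFunctor filterWellDefined).map α)) (optIso N x) (optIso M y) := by
  funext x y
  have hadj : rightAdj (KAlgFrmJ.toHom ((filterFunctor filterWellDefined).map α)) x.1 =
      filterComap (BDMS.toHom α) x.1 :=
    (gc_rightAdj _).u_unique (gc_filterMap (BDMS.toHom α)) fun _ => rfl
  exact (congrArg (· ≤ y.1) hadj).symm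

end OptimalSpace

theorem optWellDefined : OptWellDefined.{u} where
  isGPS M := isSpaceIso_optIso.isGPS
    (ppWellDefined.isGPS ((filterFunctor filterWellDefined).obj M))
  isGPMorphism α := by
    rw [optRel_eq]
    exact (ppWellDefined.isGPMorphism ((filterFunctor filterWellDefined).map α)).comp_spaceIso
      isSpaceIso_optIso isSpaceIso_optIso
  map_comp α β := by
    rw [optRel_eq, optRel_eq, optRel_eq, Functor.map_comp, ppWellDefined.map_comp]
    exact (relComp_comp_spaceIso isSpaceIso_optIso _ _ _ (OrderIso.surjective _)).symm

/-- `𝒳 ≅ 𝒴 ∘ ℱ`. -/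
def optPPIso : optFunctor optWellDefined.{u} ≅
    filterFunctor filterWellDefined ⋙ ppFunctor ppWellDefined :=
  NatIso.ofComponents
    (fun M => (GPS.isoMk (X := ((optFunctor optWellDefined).obj M).unop)
      (Y := ((filterFunctor filterWellDefined ⋙ ppFunctor ppWellDefined).obj M).unop)
      (optIso M) isSpaceIso_optIso).symm.op) fun {M N} α => by
    apply Quiver.Hom.unop_inj
    apply GPSHom.ext
    have hR := ppWellDefined.isGPMorphism ((filterFunctor filterWellDefined).map α)
    refine (congrArg (relComp _ _) (optRel_eq α)).trans ?_
    refine (relComp_comp_spaceIso isSpaceIso_optIso (· ≤ ·) _ id (optIso N).surjective).trans ?_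
    refine Eq.trans ?_
      (relComp_comp_spaceIso isSpaceIso_optIso _ (· ≤ ·) id Function.surjective_id).symm
    exact congrArg (fun R P F => R P (optIso M F)) (hR.le_relComp.trans hR.relComp_le.symm)

/-! ### The dual equivalences -/

/-- The order isomorphism between the compact elements of `L` and the admissible clopen upsets of
`PP L`, which sends `k` to `PP.above k`. -/
noncomputable def compactsPPIso (L : KAlgFrmJ.{u}) :
    CompactsDual L.obj ≃o Adm ((ppFunctor ppWellDefined).obj L).unop :=
  RelIso.ofSurjective
    (OrderEmbedding.ofMapLEIff
      (fun k => ⟨PP.above k.1, (isAdmissible_pp_iff L.2.1 L.2.2).2 ⟨k.1, k.2, rfl⟩⟩)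
      fun _ _ => PP.above_subset_above_iff L.2.1) fun ⟨U, hU⟩ => by
    obtain ⟨k, hk, rfl⟩ := (isAdmissible_pp_iff L.2.1 L.2.2).1 hU
    exact ⟨OrderDual.toDual ⟨k, hk⟩, rfl⟩

/-- `𝒦 ≅ 𝒜 ∘ 𝒴`. -/
noncomputable def compactPPIso : compactFunctor compactWellDefined.{u} ≅
    ppFunctor ppWellDefined ⋙ admFunctor admWellDefined :=
  NatIso.ofComponents (fun L => BDMS.isoMk (compactsPPIso L)) fun {L M} α => by
    apply InducedCategory.hom_ext
    apply InfTopHom.ext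
    intro k
    apply Subtype.ext
    exact (box_ppRel L.2.1 (KAlgFrmJ.toHom α) k.1).symm

/-- A fully faithful functor with a right inverse, up to isomorphism, is an equivalence. -/
noncomputable def equivalenceOfFullyFaithful {C D : Type*} [Category* C] [Category* D]
    {F : C ⥤ D} {G : D ⥤ C} (hG : G.FullyFaithful) (η : 𝟭 C ≅ F ⋙ G) : C ≌ D :=
  have := hG.full
  have := hG.faithful
  CategoryTheory.Equivalence.mk F G η (Functor.fullyFaithfulCancelRight G
    (Functor.associator G F G ≪≫ Functor.isoWhiskerLeft G η.symm ≪≫ Functor.rightUnitor G ≪≫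
      (Functor.leftUnitor G).symm))

/-- Generalized Priestley duality. -/
noncomputable def optEquivalence : BDMS.{u} ≌ GPS.{u}ᵒᵖ :=
  equivalenceOfFullyFaithful (F := optFunctor optWellDefined) fullyFaithfulAdmFunctor
    (filterUnitIso ≪≫ Functor.isoWhiskerLeft _ compactPPIso ≪≫ (Functor.associator _ _ _).symm ≪≫
      Functor.isoWhiskerRight optPPIso.symm _)

instance : (compactFunctor compactWellDefined.{u}).IsEquivalence :=
  filterEquivalence.isEquivalence_inverse

/-- `𝟭 ≅ 𝒱ᵃ ∘ 𝒴`, obtained by cancelling `𝒦` from `𝒦 ≅ 𝒜 ∘ 𝒴 ≅ 𝒦 ∘ 𝒱ᵃ ∘ 𝒴`. -/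
noncomputable def ppUnitIso : 𝟭 KAlgFrmJ.{u} ≅
    ppFunctor ppWellDefined ⋙ vietorisFunctor vietorisWellDefined :=
  Functor.fullyFaithfulCancelRight (compactFunctor compactWellDefined)
    (Functor.leftUnitor _ ≪≫ compactPPIso ≪≫ Functor.isoWhiskerLeft _ admVietorisIso ≪≫
      (Functor.associator _ _ _).symm)

/-- The dual equivalence of compact algebraic frames and generalized Priestley spaces. -/
noncomputable def ppEquivalence : KAlgFrmJ.{u} ≌ GPS.{u}ᵒᵖ :=
  equivalenceOfFullyFaithful (fullyFaithfulAdmFunctor.ofIso admVietorisIso).ofCompFaithful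
    ppUnitIso

end GenPriestley

theorem mainTheorem3 :
    -- all six prescriptions define functors
    ∃ (hF : FilterWellDefined.{u}) (hK : CompactWellDefined.{u}) (hA : AdmWellDefined.{u})
      (hX : OptWellDefined.{u}) (hV : VietorisWellDefined.{u}) (hY : PPWellDefined.{u}),
      -- the equivalence of bounded distributive meet-semilattices and compact algebraic frames
      (∃ e : BDMS.{u} ≌ KAlgFrmJ.{u},
        e.functor = filterFunctor hF ∧ e.inverse = compactFunctor hK) ∧
      -- the dual equivalence of compact algebraic frames and generalized Priestley spaces
      (∃ e : KAlgFrmJ.{u} ≌ GPS.{u}ᵒᵖ,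
        e.functor = ppFunctor hY ∧ e.inverse = vietorisFunctor hV) ∧
      -- generalized Priestley duality
      (∃ e : BDMS.{u} ≌ GPS.{u}ᵒᵖ,
        e.functor = optFunctor hX ∧ e.inverse = admFunctor hA) ∧
      -- the functors of the last duality are the compositions of the others
      (∀ (M : BDMS.{u}) (F : PFilter M.obj), IsOptimal F ↔ IsPseudoprime F) ∧
      (∃ e : optFunctor hX ≅ filterFunctor hF ⋙ ppFunctor hY,
        ∀ (M : BDMS.{u}) (P : PP (PFilter M.obj)) (F : Opt M.obj),
          (GPS.toHom (e.hom.app M).unop).rel P F ↔ P.1 ≤ F.1) ∧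
      (∃ e : admFunctor hA ≅ vietorisFunctor hV ⋙ compactFunctor hK,
        ∀ (X : GPS.{u}) (U : Adm X),
          (OrderDual.ofDual (BDMS.toHom (e.hom.app (op X)) U : CompactsDual (ClosedAdm X))).1.1
            = U.1) :=
  ⟨filterWellDefined, compactWellDefined, admWellDefined, optWellDefined,
   vietorisWellDefined, ppWellDefined,
   ⟨filterEquivalence, rfl, rfl⟩,
   ⟨ppEquivalence, rfl, rfl⟩,
   ⟨optEquivalence, rfl, rfl⟩,
   fun M _ => isOptimal_iff_isPseudoprime M.2.1 M.2.2,
   ⟨optPPIso, fun _ _ _ => Iff.rfl⟩,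
   ⟨admVietorisIso, fun _ _ => rfl⟩⟩
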